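/- For $r\ge 5$ consider the deck of $4r$ cards with $r$ ordered ranks and four suits, and let $S_r$ be the set of all $\binom{4r}{7}$ seven-card subsets of it. The hand types are HC (high card), 1P (one pair), 2P (two pair), 3X (three of a kind), ST (straight), FL (flush), FH (full house), 4X (four of a kind) and SF (straight flush). Here a straight consists of five cards of consecutive ranks, where the ace (the top rank) may also be placed below the lowest rank, and a straight flush consists of five cards that form a straight and have the same suit. Hand types are counted inclusively: five cards contain every hand type that can be formed from them; for example, every five cards contain HC, a full house contains 1P, 2P and 3X, and four of a kind contains 1P, 2P and 3X. For $s\in S_r$ write $h\in s$ if some five of the seven cards of $s$ contain a hand of type $h$. Let $$\mathrm{freq}_r(h)=|\{s\in S_r : h\in s\}|,$$ and let the frequency ranking be the one in which $h_0$ is ranked above $h_1$ exactly when $\mathrm{freq}_r(h_0)<\mathrm{freq}_r(h_1)$. Let $$\mathrm{sfreq}_r(h)=|\{s\in S_r : h\in s\text{ and } h'\notin s \text{ for every } h' \text{ ranked above } h \text{ in the frequency ranking}\}|,$$ and let the showdown ranking be the one in which $h_0$ is ranked above $h_1$ exactly when $\mathrm{sfreq}_r(h_0)<\mathrm{sfreq}_r(h_1)$.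 Then the smallest $r\ge 5$ for which the showdown ranking and the frequency ranking of all nine hand types (including high card) are equal is $r=23$. -/

import Mathlib

/-- The nine hand types: high card, one pair, two pair, three of a kind, straight, flush,
full house, four of a kind, straight flush. -/
inductive HandType where
  | HC | P1 | P2 | X3 | ST | FL | FH | X4 | SF

namespace Poker

/-- A card of the deck with `r` ranks and four suits. The ranks are listed in increasing order,
so rank `r - 1` is the ace. -/
abbrev Card (r : ℕ) : Type := Fin r × Fin 4

/-- Number of cards of rank `a` in a set of cards. -/
def rankCount {r : ℕ} (t : Finset (Card r)) (a : Fin r) : ℕ :=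
  (t.filter (fun c => c.1 = a)).card

/-- The ranks occurring in a set of cards, as natural numbers below `r`. -/
def rankSet {r : ℕ} (t : Finset (Card r)) : Finset ℕ :=
  t.image (fun c => (c.1 : ℕ))

/-- A five-card straight: five distinct ranks which are consecutive, or which are
the ace together with the four lowest ranks (the ace may be high or low). -/
def IsStraight {r : ℕ} (t : Finset (Card r)) : Prop :=
  (rankSet t).card = 5 ∧
    ((∃ k : ℕ, rankSet t = Finset.Ico k (k + 5)) ∨
      rankSet t = insert (r - 1) (Finset.range 4))

/-- All cards have the same suit. -/
def IsFlush {r : ℕ} (t : Finset (Card r)) : Prop :=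
  ∃ u : Fin 4, ∀ c ∈ t, c.2 = u

/-- `IsHand h t`: the set `t` of five cards contains a hand of type `h`. The types are inclusive:
for example a full house contains a pair, two pair and three of a kind, and every set of five
cards contains a high card. Four of a kind is regarded as containing two pair. -/
def IsHand {r : ℕ} : HandType → Finset (Card r) → Prop
  | .HC, _ => True
  | .P1, t => ∃ a, 2 ≤ rankCount t a
  | .P2, t => (∃ a b, a ≠ b ∧ 2 ≤ rankCount t a ∧ 2 ≤ rankCount t b) ∨ ∃ a, 4 ≤ rankCount t a
  | .X3, t => ∃ a, 3 ≤ rankCount t a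
  | .ST, t => IsStraight t
  | .FL, t => IsFlush t
  | .FH, t => ∃ a b, a ≠ b ∧ 3 ≤ rankCount t a ∧ 2 ≤ rankCount t b
  | .X4, t => ∃ a, 4 ≤ rankCount t a
  | .SF, t => IsStraight t ∧ IsFlush t

/-- `Contains s h`: some five of the cards in `s` contain a hand of type `h`. -/
def Contains {r : ℕ} (s : Finset (Card r)) (h : HandType) : Prop :=
  ∃ t : Finset (Card r), t ⊆ s ∧ t.card = 5 ∧ IsHand h t

/-- All sets of seven cards of the deck with `r` ranks. -/
def sevenCardHands (r : ℕ) : Finset (Finset (Card r)) :=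
  Finset.powersetCard 7 Finset.univ

open Classical in
/-- Number of sets of seven cards containing the hand type `h`. -/
noncomputable def freq (r : ℕ) (h : HandType) : ℕ :=
  ((sevenCardHands r).filter (fun s => Contains s h)).card

open Classical in
/-- Number of sets of seven cards containing `h` and no hand type ranked above `h`, where
`rk h' h` means that `h'` is ranked above `h`. -/
noncomputable def showdownFreq (r : ℕ) (rk : HandType → HandType → Prop) (h : HandType) : ℕ :=
  ((sevenCardHands r).filter
    (fun s => Contains s h ∧ ∀ h', rk h' h → ¬ Contains s h')).card

/-- The frequency ranking: `h₀` is ranked above `h₁` exactly when it is less frequent. -/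
def freqRanking (r : ℕ) (h₀ h₁ : HandType) : Prop :=
  freq r h₀ < freq r h₁

/-- The showdown ranking: `h₀` is ranked above `h₁` exactly when its showdown frequency
with respect to the frequency ranking is smaller. -/
def showdownRanking (r : ℕ) (h₀ h₁ : HandType) : Prop :=
  showdownFreq r (freqRanking r) h₀ < showdownFreq r (freqRanking r) h₁

end Poker

namespace Poker

open Finset

variable {r : ℕ}

/-! What fails below 23 is the comparison of one pair with high card. Let `N n` be the number of
straight-free sets of `n` ranks. For `r ≥ 7` high card is strictly more frequent than one pair, so
equal rankings would force the same strict order of the showdown frequencies. A showdown high card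
has seven distinct ranks, no straight and no flush. Each straight-free set of seven ranks carries
15540 flush-free suit patterns, so there are at most `15540 * N 7` such hands. Conversely, a
straight-free set of six ranks carries `6 * 5940 = 35640` flush-free one-pair hands, all of which
show down as one pair. Straight-freeness passes to subsets, so double counting gives `7 * N 7 ≤ (r -
6) * N 6`. For `r ≤ 22` this yields `15540 * N 7 ≤ 35520 * N 6 ≤ 35640 * N 6`, a contradiction. For
`r ≤ 6` no hand shows down as high card.

For `r = 23` both rankings are the chain SF, X4, FH, ST, X3, FL, P2, P1, HC, rarest first. Union
bounds, and an exact count for flushes, bound the frequencies from above; a showdown frequency is at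
most the frequency. From below, `countAvoiding` counts hands that contain a type and avoid all
earlier types of the chain. It bounds the frequency of that type, and the showdown frequency too
once the frequency chain is known. Hence one numerical gap per adjacent pair serves both rankings,
except at the top: there P1 is bounded by its one-pair profile and HC by `15540 * N 7`, with at most
3060 seven-rank sets containing a straight. -/

/-! ### Counting card sets with prescribed rank multiplicities. -/

/-- The suits in which a set of cards contains the rank `a`. -/
def slice (s : Finset (Card r)) (a : Fin r) : Finset (Fin 4) :=
  univ.filter (fun u => (a, u) ∈ s)

theorem mem_slice {s : Finset (Card r)} {a : Fin r} {u : Fin 4} :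
    u ∈ slice s a ↔ (a, u) ∈ s := by
  simp [slice]

theorem card_slice (s : Finset (Card r)) (a : Fin r) : (slice s a).card = rankCount s a := by
  unfold rankCount
  refine card_bij (fun u _ => (a, u)) ?_ ?_ ?_
  · intro u hu
    simpa using mem_slice.1 hu
  · intro u _ v _ h
    simpa using h
  · rintro ⟨b, u⟩ h
    simp only [mem_filter] at h
    obtain ⟨h1, rfl⟩ := h
    exact ⟨u, mem_slice.2 h1, rfl⟩

/-- A set of cards amounts to an independent choice of a suit set for every rank, so rankwise
constraints multiply. -/
theorem card_box (c : Fin r → Finset (Finset (Fin 4))) :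
    (univ.filter fun s : Finset (Card r) => ∀ a, slice s a ∈ c a).card = ∏ a, (c a).card := by
  rw [← Fintype.card_piFinset]
  refine card_nbij' slice (fun f => univ.filter (fun x => x.2 ∈ f x.1)) ?_ ?_ ?_ ?_
  · intro s hs
    simpa using hs
  · intro f hf
    have h : ∀ a, slice (univ.filter (fun x : Card r => x.2 ∈ f x.1)) a = f a := by
      intro a; ext u; simp [mem_slice]
    simpa [h] using hf
  · intro s _
    ext ⟨a, u⟩
    simp [mem_slice]
  · intro f _
    funext a
    ext u
    simp [mem_slice]

theorem sum_rankCount (s : Finset (Card r)) : ∑ a, rankCount s a = s.card :=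
  (card_eq_sum_card_fiberwise (f := fun x : Card r => x.1) (t := univ) (by simp)).symm

theorem rankCount_le_four (s : Finset (Card r)) (a : Fin r) : rankCount s a ≤ 4 := by
  rw [← card_slice]
  exact card_finset_fin_le _

theorem rankCount_mono {s t : Finset (Card r)} (h : t ⊆ s) (a : Fin r) :
    rankCount t a ≤ rankCount s a :=
  card_le_card (filter_subset_filter _ h)

theorem card_profile (m : Fin r → ℕ) :
    (univ.filter fun s : Finset (Card r) => ∀ a, rankCount s a = m a).card =
      ∏ a, Nat.choose 4 (m a) := by
  have h := card_box (fun a => powersetCard (m a) (univ : Finset (Fin 4)))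
  simpa [card_slice, mem_powersetCard] using h

/-- The ranks of which a set of cards contains exactly `i` cards. -/
def ranksWith (s : Finset (Card r)) (i : ℕ) : Finset (Fin r) :=
  univ.filter (fun a => rankCount s a = i)

theorem mem_ranksWith {s : Finset (Card r)} {i : ℕ} {a : Fin r} :
    a ∈ ranksWith s i ↔ rankCount s a = i := by
  simp [ranksWith]

theorem disjoint_ranksWith (s : Finset (Card r)) {i j : ℕ} (h : i ≠ j) :
    Disjoint (ranksWith s i) (ranksWith s j) := by
  rw [disjoint_left]
  intro a h1 h2
  rw [mem_ranksWith] at h1 h2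
  omega

/-- The sets of cards with `l`, `i`, `j`, `k` ranks of multiplicity four, three, two, one. -/
def ofType (r l i j k : ℕ) : Finset (Finset (Card r)) :=
  univ.filter fun s => (ranksWith s 4).card = l ∧ (ranksWith s 3).card = i ∧
    (ranksWith s 2).card = j ∧ (ranksWith s 1).card = k

theorem mem_ofType {l i j k : ℕ} {s : Finset (Card r)} :
    s ∈ ofType r l i j k ↔ (ranksWith s 4).card = l ∧ (ranksWith s 3).card = i ∧
      (ranksWith s 2).card = j ∧ (ranksWith s 1).card = k := by
  simp [ofType]

theorem card_of_types (s : Finset (Card r)) :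
    s.card = 4 * (ranksWith s 4).card + 3 * (ranksWith s 3).card + 2 * (ranksWith s 2).card +
      (ranksWith s 1).card := by
  rw [← sum_rankCount]
  have h : ∀ a, rankCount s a = (if rankCount s a = 4 then 4 else 0) +
      (if rankCount s a = 3 then 3 else 0) + (if rankCount s a = 2 then 2 else 0) +
      (if rankCount s a = 1 then 1 else 0) := by
    intro a
    have := rankCount_le_four s a
    interval_cases rankCount s a <;> rfl
  rw [sum_congr rfl (fun a _ => h a)]
  simp only [sum_add_distrib, ← sum_filter, sum_const, ranksWith, smul_eq_mul]
  ring

/-- The four disjoint sets determine every multiplicity, and ranks of multiplicity 4, 3, 2, 1 have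
1, 4, 6, 4 suit choices. -/
theorem card_ranksWith_eq (A B C D : Finset (Fin r)) (hB : Disjoint A B)
    (hC : Disjoint (A ∪ B) C) (hD : Disjoint (A ∪ B ∪ C) D) :
    (univ.filter fun s : Finset (Card r) => ranksWith s 4 = A ∧ ranksWith s 3 = B ∧
      ranksWith s 2 = C ∧ ranksWith s 1 = D).card = 4 ^ B.card * 6 ^ C.card * 4 ^ D.card := by
  let m : Fin r → ℕ := fun a => if a ∈ A then 4 else if a ∈ B then 3 else if a ∈ C then 2 else
    if a ∈ D then 1 else 0
  have h1 : (univ.filter fun s : Finset (Card r) => ranksWith s 4 = A ∧ ranksWith s 3 = B ∧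
      ranksWith s 2 = C ∧ ranksWith s 1 = D) =
      univ.filter fun s : Finset (Card r) => ∀ a, rankCount s a = m a := by
    ext s
    simp only [mem_filter, mem_univ, true_and, Finset.ext_iff, mem_ranksWith]
    rw [disjoint_left] at hB hC hD
    simp only [mem_union] at hC hD
    constructor
    · rintro ⟨h4, h3, h2, h1⟩ a
      have := rankCount_le_four s a
      simp only [m, ← h4, ← h3, ← h2, ← h1]
      split_ifs <;> omega
    · intro h
      refine ⟨fun a => ?_, fun a => ?_, fun a => ?_, fun a => ?_⟩ <;>
      · rw [h a]
        have := @hB a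
        have := @hC a
        have := @hD a
        simp only [m]
        split_ifs <;> simp_all
  rw [h1, card_profile]
  have h2 : ∀ a, Nat.choose 4 (m a) = (if a ∈ B then 4 else 1) * (if a ∈ C then 6 else 1) *
      (if a ∈ D then 4 else 1) := by
    intro a
    rw [disjoint_left] at hB hC hD
    have := @hB a
    have := @hC a
    have := @hD a
    simp only [mem_union] at *
    simp only [m]
    split_ifs <;> simp_all
    rfl
  rw [prod_congr rfl (fun a _ => h2 a)]
  simp only [prod_mul_distrib, prod_ite_mem, univ_inter, prod_const]

/-- The rank sets are chosen successively, each in the complement of the earlier ones; every choice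
has the same number of suit patterns. -/
theorem card_ofType (r l i j k : ℕ) :
    (ofType r l i j k).card = (r.choose l * ((r - l).choose i * ((r - l - i).choose j *
      (r - l - i - j).choose k))) * (4 ^ i * 6 ^ j * 4 ^ k) := by
  let I : Finset (Σ _ : Finset (Fin r), Σ _ : Finset (Fin r), Σ _ : Finset (Fin r),
      Finset (Fin r)) :=
    (powersetCard l univ).sigma fun A => (powersetCard i Aᶜ).sigma fun B =>
      (powersetCard j (A ∪ B)ᶜ).sigma fun C => powersetCard k (A ∪ B ∪ C)ᶜ
  have key : ∀ {X Y : Finset (Fin r)}, Y ⊆ Xᶜ ↔ Disjoint X Y := by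
    intro X Y
    rw [subset_compl_comm]
    exact le_compl_iff_disjoint_right
  have hI : ∀ x ∈ I, (Disjoint x.1 x.2.1 ∧ Disjoint (x.1 ∪ x.2.1) x.2.2.1 ∧
      Disjoint (x.1 ∪ x.2.1 ∪ x.2.2.1) x.2.2.2) ∧ x.1.card = l ∧ x.2.1.card = i ∧
      x.2.2.1.card = j ∧ x.2.2.2.card = k := by
    rintro ⟨A, B, C, D⟩ h
    simp only [I, mem_sigma, mem_powersetCard, key] at h
    tauto
  have hmem : ∀ s ∈ ofType r l i j k,
      (⟨ranksWith s 4, ranksWith s 3, ranksWith s 2, ranksWith s 1⟩ :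
        Σ _ : Finset (Fin r), Σ _ : Finset (Fin r), Σ _ : Finset (Fin r),
          Finset (Fin r)) ∈ I := by
    intro s hs
    rw [mem_ofType] at hs
    simp only [I, mem_sigma, mem_powersetCard, key, disjoint_union_left]
    refine ⟨⟨subset_univ _, hs.1⟩, ⟨?_, hs.2.1⟩, ⟨⟨?_, ?_⟩, hs.2.2.1⟩, ⟨⟨?_, ?_⟩, ?_⟩, hs.2.2.2⟩ <;>
      exact disjoint_ranksWith s (by norm_num)
  rw [card_eq_sum_card_fiberwise hmem]
  have hf : ∀ x ∈ I, ((ofType r l i j k).filter fun s =>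
      (⟨ranksWith s 4, ranksWith s 3, ranksWith s 2, ranksWith s 1⟩ :
        Σ _ : Finset (Fin r), Σ _ : Finset (Fin r), Σ _ : Finset (Fin r),
          Finset (Fin r)) = x).card = 4 ^ i * 6 ^ j * 4 ^ k := by
    intro x hx
    obtain ⟨⟨h1, h2, h3⟩, h4, h5, h6, h7⟩ := hI x hx
    have := card_ranksWith_eq x.1 x.2.1 x.2.2.1 x.2.2.2 h1 h2 h3
    rw [h5, h6, h7] at this
    rw [← this]
    congr 1
    ext s
    obtain ⟨A, B, C, D⟩ := x
    simp only [mem_filter, mem_univ, true_and, mem_ofType, Sigma.mk.injEq, heq_eq_eq]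
    constructor
    · exact fun h => h.2
    · rintro ⟨rfl, rfl, rfl, rfl⟩
      exact ⟨⟨h4, h5, h6, h7⟩, rfl, rfl, rfl, rfl⟩
  rw [sum_congr rfl hf, sum_const, smul_eq_mul]
  congr 1
  have e1 : ∀ A ∈ powersetCard l (univ : Finset (Fin r)),
      ((powersetCard i Aᶜ).sigma fun B => (powersetCard j (A ∪ B)ᶜ).sigma fun C =>
        powersetCard k (A ∪ B ∪ C)ᶜ).card =
      (r - l).choose i * ((r - l - i).choose j * (r - l - i - j).choose k) := by
    intro A hA
    rw [card_sigma]
    have e2 : ∀ B ∈ powersetCard i Aᶜ, ((powersetCard j (A ∪ B)ᶜ).sigma fun C =>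
        powersetCard k (A ∪ B ∪ C)ᶜ).card =
        (r - l - i).choose j * (r - l - i - j).choose k := by
      intro B hB
      rw [mem_powersetCard, key] at hB
      rw [mem_powersetCard] at hA
      rw [card_sigma]
      have e3 : ∀ C ∈ powersetCard j (A ∪ B)ᶜ, (powersetCard k (A ∪ B ∪ C)ᶜ).card =
          (r - l - i - j).choose k := by
        intro C hC
        rw [mem_powersetCard, key] at hC
        rw [card_powersetCard, card_compl, card_union_of_disjoint hC.1,
          card_union_of_disjoint hB.1, hA.2, hB.2, hC.2, Fintype.card_fin]
        congr 1
        omega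
      rw [sum_congr rfl e3, sum_const, card_powersetCard, card_compl,
        card_union_of_disjoint hB.1, hA.2, hB.2, Fintype.card_fin, smul_eq_mul]
      congr 2
      omega
    rw [sum_congr rfl e2, sum_const, card_powersetCard, card_compl,
      (mem_powersetCard.1 hA).2, Fintype.card_fin, smul_eq_mul]
  rw [card_sigma, sum_congr rfl e1, sum_const, card_powersetCard, card_univ, Fintype.card_fin,
    smul_eq_mul]

/-! ### Hand types of seven cards in terms of ranks and suits. -/

/-- The ranks occurring in a set of cards. -/
def ranks (s : Finset (Card r)) : Finset (Fin r) :=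
  univ.filter (fun a => 1 ≤ rankCount s a)

theorem mem_ranks {s : Finset (Card r)} {a : Fin r} : a ∈ ranks s ↔ 1 ≤ rankCount s a := by
  simp [ranks]

theorem mem_ranks_iff {s : Finset (Card r)} {a : Fin r} :
    a ∈ ranks s ↔ ∃ u, (a, u) ∈ s := by
  rw [mem_ranks, ← card_slice, Nat.succ_le_iff, card_pos]
  simp [Finset.Nonempty, mem_slice]

theorem rankSet_eq_map (s : Finset (Card r)) : rankSet s = (ranks s).map Fin.valEmbedding := by
  ext n
  simp only [rankSet, mem_image, mem_map, mem_ranks_iff]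
  constructor
  · rintro ⟨⟨a, u⟩, h, rfl⟩
    exact ⟨a, ⟨u, h⟩, rfl⟩
  · rintro ⟨a, ⟨u, h⟩, rfl⟩
    exact ⟨(a, u), h, rfl⟩

theorem ranks_mono {s t : Finset (Card r)} (h : t ⊆ s) : ranks t ⊆ ranks s := by
  intro a
  simp only [mem_ranks_iff]
  exact fun ⟨u, hu⟩ => ⟨u, h hu⟩

/-- A set of five ranks which forms a straight. -/
def IsStraightRanks (R : Finset (Fin r)) : Prop :=
  R.card = 5 ∧ ((∃ k : ℕ, R.map Fin.valEmbedding = Ico k (k + 5)) ∨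
    R.map Fin.valEmbedding = insert (r - 1) (range 4))

/-- A set of ranks which contains a straight. -/
def HasStraight (B : Finset (Fin r)) : Prop :=
  ∃ R ⊆ B, IsStraightRanks R

theorem HasStraight.mono {A B : Finset (Fin r)} (h : A ⊆ B) (hA : HasStraight A) :
    HasStraight B := by
  obtain ⟨R, hR, h1⟩ := hA
  exact ⟨R, hR.trans h, h1⟩

theorem isStraight_iff (t : Finset (Card r)) : IsStraight t ↔ IsStraightRanks (ranks t) := by
  unfold IsStraight IsStraightRanks
  rw [rankSet_eq_map, card_map]

/-- The cards of suit `u` in a set of cards. -/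
def ofSuit (s : Finset (Card r)) (u : Fin 4) : Finset (Card r) :=
  s.filter (fun c => c.2 = u)

theorem contains_HC {s : Finset (Card r)} (hs : s.card = 7) : Contains s .HC := by
  obtain ⟨t, h1, h2⟩ := exists_subset_card_eq (s := s) (n := 5) (by omega)
  exact ⟨t, h1, h2, trivial⟩

/-- A witness of at most five cards can be padded inside `s` to exactly five, provided the hand type
survives adding cards. -/
theorem contains_of_subset {s t : Finset (Card r)} (hs : s.card = 7) (ht : t.card ≤ 5)
    (hts : t ⊆ s) {h : HandType} (hh : ∀ t', t ⊆ t' → IsHand h t') : Contains s h := by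
  obtain ⟨t', h1, h2, h3⟩ := exists_subsuperset_card_eq hts ht (by omega)
  exact ⟨t', h2, h3, hh t' h1⟩

theorem exists_subset_rankCount {s : Finset (Card r)} {a : Fin r} {n : ℕ}
    (h : n ≤ rankCount s a) : ∃ t ⊆ s, t.card = n ∧ ∀ t', t ⊆ t' → n ≤ rankCount t' a := by
  obtain ⟨t, h1, h2⟩ := exists_subset_card_eq h
  refine ⟨t, h1.trans (filter_subset _ _), h2, fun t' ht' => ?_⟩
  rw [← h2]
  refine card_le_card fun c hc => mem_filter.2 ⟨ht' hc, (mem_filter.1 (h1 hc)).2⟩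

theorem contains_P1_iff {s : Finset (Card r)} (hs : s.card = 7) :
    Contains s .P1 ↔ ∃ a, 2 ≤ rankCount s a := by
  constructor
  · rintro ⟨t, hts, -, a, ha⟩
    exact ⟨a, ha.trans (rankCount_mono hts a)⟩
  · rintro ⟨a, ha⟩
    obtain ⟨t, h1, h2, h3⟩ := exists_subset_rankCount ha
    exact contains_of_subset hs (by omega) h1 fun t' ht' => ⟨a, h3 t' ht'⟩

theorem contains_X3_iff {s : Finset (Card r)} (hs : s.card = 7) :
    Contains s .X3 ↔ ∃ a, 3 ≤ rankCount s a := by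
  constructor
  · rintro ⟨t, hts, -, a, ha⟩
    exact ⟨a, ha.trans (rankCount_mono hts a)⟩
  · rintro ⟨a, ha⟩
    obtain ⟨t, h1, h2, h3⟩ := exists_subset_rankCount ha
    exact contains_of_subset hs (by omega) h1 fun t' ht' => ⟨a, h3 t' ht'⟩

theorem contains_X4_iff {s : Finset (Card r)} (hs : s.card = 7) :
    Contains s .X4 ↔ ∃ a, 4 ≤ rankCount s a := by
  constructor
  · rintro ⟨t, hts, -, a, ha⟩
    exact ⟨a, ha.trans (rankCount_mono hts a)⟩
  · rintro ⟨a, ha⟩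
    obtain ⟨t, h1, h2, h3⟩ := exists_subset_rankCount ha
    exact contains_of_subset hs (by omega) h1 fun t' ht' => ⟨a, h3 t' ht'⟩

theorem contains_P2_iff {s : Finset (Card r)} (hs : s.card = 7) :
    Contains s .P2 ↔ (∃ a b, a ≠ b ∧ 2 ≤ rankCount s a ∧ 2 ≤ rankCount s b) ∨
      ∃ a, 4 ≤ rankCount s a := by
  constructor
  · rintro ⟨t, hts, -, ⟨a, b, hab, ha, hb⟩ | ⟨a, ha⟩⟩
    · exact .inl ⟨a, b, hab, ha.trans (rankCount_mono hts a), hb.trans (rankCount_mono hts b)⟩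
    · exact .inr ⟨a, ha.trans (rankCount_mono hts a)⟩
  · rintro (⟨a, b, hab, ha, hb⟩ | ⟨a, ha⟩)
    · obtain ⟨t, h1, h2, h3⟩ := exists_subset_rankCount ha
      obtain ⟨t', h1', h2', h3'⟩ := exists_subset_rankCount hb
      have := card_union_le t t'
      exact contains_of_subset hs (by omega) (union_subset h1 h1') fun x hx => Or.inl
        ⟨a, b, hab, h3 x (subset_union_left.trans hx), h3' x (subset_union_right.trans hx)⟩
    · obtain ⟨t, h1, h2, h3⟩ := exists_subset_rankCount ha
      exact contains_of_subset hs (by omega) h1 fun t' ht' => Or.inr ⟨a, h3 t' ht'⟩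

theorem contains_FH_iff {s : Finset (Card r)} (hs : s.card = 7) :
    Contains s .FH ↔ ∃ a b, a ≠ b ∧ 3 ≤ rankCount s a ∧ 2 ≤ rankCount s b := by
  constructor
  · rintro ⟨t, hts, -, a, b, hab, ha, hb⟩
    exact ⟨a, b, hab, ha.trans (rankCount_mono hts a), hb.trans (rankCount_mono hts b)⟩
  · rintro ⟨a, b, hab, ha, hb⟩
    obtain ⟨t, h1, h2, h3⟩ := exists_subset_rankCount ha
    obtain ⟨t', h1', h2', h3'⟩ := exists_subset_rankCount hb
    have := card_union_le t t'
    exact contains_of_subset hs (by omega) (union_subset h1 h1') fun x hx =>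
      ⟨a, b, hab, h3 x (subset_union_left.trans hx), h3' x (subset_union_right.trans hx)⟩

theorem contains_FL_iff {s : Finset (Card r)} :
    Contains s .FL ↔ ∃ u, 5 ≤ (ofSuit s u).card := by
  constructor
  · rintro ⟨t, hts, ht, u, hu⟩
    exact ⟨u, ht ▸ card_le_card fun c hc => mem_filter.2 ⟨hts hc, hu c hc⟩⟩
  · rintro ⟨u, hu⟩
    obtain ⟨t, h1, h2⟩ := exists_subset_card_eq hu
    exact ⟨t, h1.trans (filter_subset _ _), h2, u, fun c hc => (mem_filter.1 (h1 hc)).2⟩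

theorem contains_ST_iff {s : Finset (Card r)} : Contains s .ST ↔ HasStraight (ranks s) := by
  constructor
  · rintro ⟨t, hts, -, ht⟩
    exact ⟨ranks t, ranks_mono hts, (isStraight_iff t).1 ht⟩
  · rintro ⟨R, hR, h⟩
    -- One card per rank of the straight suffices, whatever its suit.
    choose f hf using fun a : R => mem_ranks_iff.1 (hR a.2)
    let e : R ↪ Card r := ⟨fun a => (a.1, f a), fun a b hab => by
      simp only [Prod.mk.injEq] at hab
      exact Subtype.ext hab.1⟩
    refine ⟨univ.map e, ?_, by simp [h.1], ?_⟩
    · intro c hc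
      obtain ⟨a, -, rfl⟩ := mem_map.1 hc
      exact hf a
    · refine (isStraight_iff _).2 ?_
      convert h
      ext a
      simp only [mem_ranks_iff, mem_map, mem_univ, true_and]
      constructor
      · rintro ⟨u, b, hb⟩
        have h1 : (b : Fin r) = a := congrArg Prod.fst hb
        exact h1 ▸ b.2
      · exact fun ha => ⟨f ⟨a, ha⟩, ⟨a, ha⟩, rfl⟩

theorem contains_SF_imp {s : Finset (Card r)} (h : Contains s .SF) :
    Contains s .ST ∧ Contains s .FL := by
  obtain ⟨t, h1, h2, h3, h4⟩ := h
  exact ⟨⟨t, h1, h2, h3⟩, ⟨t, h1, h2, h4⟩⟩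

theorem five_le_card_ranks_of_hasStraight {s : Finset (Card r)} (h : HasStraight (ranks s)) :
    5 ≤ (ranks s).card := by
  obtain ⟨R, h1, h2⟩ := h
  exact h2.1 ▸ card_le_card h1

/-- Cards of one suit have distinct ranks; hence a flush, like a straight, needs five ranks. -/
theorem card_ofSuit_le_card_ranks (s : Finset (Card r)) (u : Fin 4) :
    (ofSuit s u).card ≤ (ranks s).card := by
  refine card_le_card_of_injOn (fun c => c.1) ?_ ?_
  · rintro ⟨a, v⟩ h
    exact mem_ranks_iff.2 ⟨v, (mem_filter.1 h).1⟩
  · rintro ⟨a, v⟩ h ⟨b, w⟩ h' hab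
    have h1 := (mem_filter.1 h).2
    have h2 := (mem_filter.1 h').2
    simp_all

theorem card_ranks_eq (s : Finset (Card r)) :
    (ranks s).card = (ranksWith s 4).card + (ranksWith s 3).card + (ranksWith s 2).card +
      (ranksWith s 1).card := by
  have h : ∀ a, (if 1 ≤ rankCount s a then 1 else 0) = (if rankCount s a = 4 then 1 else 0) +
      (if rankCount s a = 3 then 1 else 0) + (if rankCount s a = 2 then 1 else 0) +
      (if rankCount s a = 1 then 1 else 0) := by
    intro a
    have := rankCount_le_four s a
    interval_cases rankCount s a <;> rfl
  simp only [ranks, ranksWith, card_filter]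
  rw [sum_congr rfl (fun a _ => h a)]
  simp only [sum_add_distrib]

theorem card_two_le (s : Finset (Card r)) :
    (univ.filter fun a => 2 ≤ rankCount s a).card =
      (ranksWith s 4).card + (ranksWith s 3).card + (ranksWith s 2).card := by
  have h : ∀ a, (if 2 ≤ rankCount s a then 1 else 0) = (if rankCount s a = 4 then 1 else 0) +
      (if rankCount s a = 3 then 1 else 0) + (if rankCount s a = 2 then 1 else 0) := by
    intro a
    have := rankCount_le_four s a
    interval_cases rankCount s a <;> rfl
  simp only [ranksWith, card_filter]
  rw [sum_congr rfl (fun a _ => h a)]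
  simp only [sum_add_distrib]

theorem card_three_le (s : Finset (Card r)) :
    (univ.filter fun a => 3 ≤ rankCount s a).card =
      (ranksWith s 4).card + (ranksWith s 3).card := by
  have h : ∀ a, (if 3 ≤ rankCount s a then 1 else 0) = (if rankCount s a = 4 then 1 else 0) +
      (if rankCount s a = 3 then 1 else 0) := by
    intro a
    have := rankCount_le_four s a
    interval_cases rankCount s a <;> rfl
  simp only [ranksWith, card_filter]
  rw [sum_congr rfl (fun a _ => h a)]
  simp only [sum_add_distrib]

/-! Hand types in terms of the number of ranks of each multiplicity. -/

theorem contains_P1_iff_card {s : Finset (Card r)} (hs : s.card = 7) : Contains s .P1 ↔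
    0 < (ranksWith s 4).card + (ranksWith s 3).card + (ranksWith s 2).card := by
  rw [contains_P1_iff hs, ← card_two_le, card_pos, filter_nonempty_iff]
  simp

theorem contains_X3_iff_card {s : Finset (Card r)} (hs : s.card = 7) : Contains s .X3 ↔
    0 < (ranksWith s 4).card + (ranksWith s 3).card := by
  rw [contains_X3_iff hs, ← card_three_le, card_pos, filter_nonempty_iff]
  simp

theorem contains_X4_iff_card {s : Finset (Card r)} (hs : s.card = 7) : Contains s .X4 ↔
    0 < (ranksWith s 4).card := by
  rw [contains_X4_iff hs, ranksWith, card_pos, filter_nonempty_iff]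
  simp only [mem_univ, true_and]
  exact exists_congr fun a => (rankCount_le_four s a).ge_iff_eq

theorem contains_P2_iff_card {s : Finset (Card r)} (hs : s.card = 7) : Contains s .P2 ↔
    1 < (ranksWith s 4).card + (ranksWith s 3).card + (ranksWith s 2).card ∨
      0 < (ranksWith s 4).card := by
  rw [← contains_X4_iff_card hs, contains_X4_iff hs, contains_P2_iff hs, ← card_two_le,
    one_lt_card_iff]
  simp only [mem_filter, mem_univ, true_and]
  refine or_congr ?_ Iff.rfl
  exact exists_congr fun a => exists_congr fun b => by tauto

theorem contains_FH_iff_card {s : Finset (Card r)} (hs : s.card = 7) : Contains s .FH ↔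
    0 < (ranksWith s 4).card + (ranksWith s 3).card ∧
    1 < (ranksWith s 4).card + (ranksWith s 3).card + (ranksWith s 2).card := by
  rw [contains_FH_iff hs, ← card_two_le, ← card_three_le]
  constructor
  · rintro ⟨a, b, hab, ha, hb⟩
    exact ⟨card_pos.2 ⟨a, by simpa using ha⟩,
      one_lt_card_iff.2 ⟨a, b, by simp; omega, by simpa using hb, hab⟩⟩
  · rintro ⟨h1, h2⟩
    obtain ⟨a, ha⟩ := card_pos.1 h1
    obtain ⟨b, hb, hab⟩ := exists_mem_ne h2 a
    exact ⟨a, b, hab.symm, (mem_filter.1 ha).2, (mem_filter.1 hb).2⟩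

theorem contains_ST_imp_card {s : Finset (Card r)} (h : Contains s .ST) :
    5 ≤ (ranksWith s 4).card + (ranksWith s 3).card + (ranksWith s 2).card +
      (ranksWith s 1).card := by
  rw [← card_ranks_eq]
  exact five_le_card_ranks_of_hasStraight (contains_ST_iff.1 h)

theorem contains_FL_imp_card {s : Finset (Card r)} (h : Contains s .FL) :
    5 ≤ (ranksWith s 4).card + (ranksWith s 3).card + (ranksWith s 2).card +
      (ranksWith s 1).card := by
  rw [← card_ranks_eq]
  obtain ⟨u, hu⟩ := contains_FL_iff.1 h
  exact hu.trans (card_ofSuit_le_card_ranks s u)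

/-! ### Flush-free suit patterns on a fixed set of ranks. -/

/-- The ranks of the cards of suit `u`. -/
def suitRanks (s : Finset (Card r)) (u : Fin 4) : Finset (Fin r) :=
  univ.filter (fun a => (a, u) ∈ s)

theorem card_suitRanks (s : Finset (Card r)) (u : Fin 4) :
    (suitRanks s u).card = (ofSuit s u).card := by
  refine card_bij (fun a _ => (a, u)) ?_ ?_ ?_
  · intro a ha
    simpa [suitRanks, ofSuit] using ha
  · intro a _ b _ h
    simpa using h
  · rintro ⟨a, v⟩ h
    obtain ⟨h1, rfl⟩ := mem_filter.1 h
    exact ⟨a, by simpa [suitRanks] using h1, rfl⟩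

/-- No five cards of `s` have the same suit. -/
def FlushFree (s : Finset (Card r)) : Prop :=
  ∀ u, (ofSuit s u).card < 5

instance (s : Finset (Card r)) : Decidable (FlushFree s) :=
  inferInstanceAs (Decidable (∀ u, (ofSuit s u).card < 5))

theorem not_contains_FL_iff {s : Finset (Card r)} : ¬ Contains s .FL ↔ FlushFree s := by
  simp [contains_FL_iff, FlushFree]

theorem sum_card_ofSuit (s : Finset (Card r)) : ∑ u, (ofSuit s u).card = s.card :=
  (card_eq_sum_card_fiberwise (f := fun x : Card r => x.2) (t := univ) (by simp)).symm

theorem card_ofSuit_add_le (s : Finset (Card r)) {u v : Fin 4} (h : u ≠ v) :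
    (ofSuit s u).card + (ofSuit s v).card ≤ s.card := by
  rw [← sum_card_ofSuit s, ← sum_pair (f := fun u => (ofSuit s u).card) h]
  exact sum_le_sum_of_subset (subset_univ _)

/-- Two flush suits would need ten cards, so the events for different suits are disjoint. -/
theorem card_filter_exists_suit (F : Finset (Finset (Card r))) (hF : ∀ s ∈ F, s.card = 7) :
    (F.filter fun s => ∃ u, 5 ≤ (ofSuit s u).card).card =
      ∑ u, (F.filter fun s => 5 ≤ (ofSuit s u).card).card := by
  rw [← card_biUnion]
  · congr 1
    ext s
    simp
  · intro u _ v _ huv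
    rw [Function.onFun, disjoint_left]
    intro s h1 h2
    simp only [mem_filter] at h1 h2
    have := card_ofSuit_add_le s huv
    have := hF s h1.1
    omega

theorem card_filter_flushFree (F : Finset (Finset (Card r))) (hF : ∀ s ∈ F, s.card = 7) :
    (F.filter FlushFree).card + ∑ u, (F.filter fun s => 5 ≤ (ofSuit s u).card).card =
      F.card := by
  rw [← card_filter_exists_suit F hF, ← card_filter_add_card_filter_not (s := F) FlushFree]
  congr 3
  ext s
  simp [FlushFree]

/-- The sets of cards with exactly `m a` cards of rank `a`. -/
def withProfile (m : Fin r → ℕ) : Finset (Finset (Card r)) :=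
  univ.filter fun s => ∀ a, rankCount s a = m a

theorem mem_withProfile {m : Fin r → ℕ} {s : Finset (Card r)} :
    s ∈ withProfile m ↔ ∀ a, rankCount s a = m a := by
  simp [withProfile]

theorem card_withProfile_suitRanks (m : Fin r → ℕ) (u : Fin 4) (T : Finset (Fin r)) :
    ((withProfile m).filter fun s => suitRanks s u = T).card =
      ∏ a, ((powersetCard (m a) (univ : Finset (Fin 4))).filter fun x => u ∈ x ↔ a ∈ T).card := by
  rw [← card_box]
  congr 1
  ext s
  simp only [mem_filter, mem_withProfile, mem_univ, true_and, mem_powersetCard, card_slice,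
    subset_univ, mem_slice, forall_and, Finset.ext_iff, suitRanks]

theorem suitRanks_subset {m : Fin r → ℕ} {s : Finset (Card r)} (hs : s ∈ withProfile m)
    (u : Fin 4) {B : Finset (Fin r)} (hB : ∀ a ∉ B, m a = 0) : suitRanks s u ⊆ B := by
  intro a ha
  by_contra h
  have h1 := hB a h
  rw [← mem_withProfile.1 hs a] at h1
  have : 1 ≤ rankCount s a := mem_ranks.1 (mem_ranks_iff.2 ⟨u, by simpa [suitRanks] using ha⟩)
  omega

/-- Sorting by the exact set `T` of ranks held in suit `u` reduces the flush count to the products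
of `card_withProfile_suitRanks`. -/
theorem card_withProfile_flush (m : Fin r → ℕ) (u : Fin 4) (B : Finset (Fin r))
    (hB : ∀ a ∉ B, m a = 0) (w : Finset (Fin r) → ℕ)
    (hw : ∀ T ⊆ B, ((withProfile m).filter fun s => suitRanks s u = T).card = w T) :
    ((withProfile m).filter fun s => 5 ≤ (ofSuit s u).card).card =
      ∑ T ∈ B.powerset, if 5 ≤ T.card then w T else 0 := by
  have hmap : ∀ s ∈ (withProfile m).filter fun s => 5 ≤ (ofSuit s u).card,
      suitRanks s u ∈ B.powerset := fun s hs =>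
    mem_powerset.2 (suitRanks_subset (mem_filter.1 hs).1 u hB)
  rw [card_eq_sum_card_fiberwise hmap]
  refine sum_congr rfl fun T hT => ?_
  rw [filter_filter]
  split_ifs with h
  · rw [← hw T (mem_powerset.1 hT)]
    congr 1
    refine filter_congr fun s _ => ?_
    rw [← card_suitRanks]
    constructor
    · exact fun h => h.2
    · rintro rfl
      exact ⟨h, rfl⟩
  · rw [card_eq_zero, filter_eq_empty_iff]
    rintro s - ⟨h1, rfl⟩
    rw [card_suitRanks] at h
    exact h h1

/-- Each rank in `B` occurs once. -/
def single (B : Finset (Fin r)) (a : Fin r) : ℕ := if a ∈ B then 1 else 0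

/-- The rank `b` occurs twice, and each rank in `B` once. -/
def pairSingle (b : Fin r) (B : Finset (Fin r)) (a : Fin r) : ℕ :=
  if a = b then 2 else if a ∈ B then 1 else 0

theorem card_powersetCard_filter_mem (u : Fin 4) :
    ((powersetCard 0 (univ : Finset (Fin 4))).filter fun x => u ∈ x ↔ False).card = 1 ∧
    ((powersetCard 1 (univ : Finset (Fin 4))).filter fun x => u ∈ x ↔ True).card = 1 ∧
    ((powersetCard 1 (univ : Finset (Fin 4))).filter fun x => u ∈ x ↔ False).card = 3 ∧
    ((powersetCard 2 (univ : Finset (Fin 4))).filter fun x => u ∈ x ↔ True).card = 3 ∧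
    ((powersetCard 2 (univ : Finset (Fin 4))).filter fun x => u ∈ x ↔ False).card = 3 := by
  revert u
  decide

/-- Ranks in `T` are forced to suit `u`; each other rank of `B` has three suits left. -/
theorem card_single_suitRanks (B : Finset (Fin r)) (u : Fin 4) {T : Finset (Fin r)}
    (hT : T ⊆ B) : ((withProfile (single B)).filter fun s => suitRanks s u = T).card =
      3 ^ (B.card - T.card) := by
  rw [card_withProfile_suitRanks, ← card_sdiff_of_subset hT, ← prod_const, ← prod_subset
    (subset_univ (B \ T))]
  · refine prod_congr rfl fun a ha => ?_
    rw [mem_sdiff] at ha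
    simp only [single, ha.1, ha.2, if_true]
    exact (card_powersetCard_filter_mem u).2.2.1
  · intro a _ ha
    rw [mem_sdiff] at ha
    by_cases h : a ∈ B
    · have h1 : a ∈ T := by tauto
      simp only [single, h, h1, if_true]
      exact (card_powersetCard_filter_mem u).2.1
    · have h1 : a ∉ T := fun h' => h (hT h')
      simp only [single, h, h1, if_false]
      exact (card_powersetCard_filter_mem u).1

/-- The paired rank has three suit pairs with `u` and three without, so its factor is 3 whether or
not `b ∈ T`; only `T.erase b` affects the count. -/
theorem card_pairSingle_suitRanks (b : Fin r) (B : Finset (Fin r)) (hb : b ∉ B) (u : Fin 4)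
    {T : Finset (Fin r)} (hT : T ⊆ insert b B) :
    ((withProfile (pairSingle b B)).filter fun s => suitRanks s u = T).card =
      3 * 3 ^ (B.card - (T.erase b).card) := by
  have hT' : T.erase b ⊆ B := by
    rw [← subset_insert_iff]
    exact hT
  rw [card_withProfile_suitRanks, ← card_sdiff_of_subset hT', ← prod_const]
  have hb' : b ∉ B \ T.erase b := fun h => hb (mem_sdiff.1 h).1
  rw [← prod_subset (subset_univ (insert b (B \ T.erase b))), prod_insert hb']
  · congr 1
    · simp only [pairSingle, if_true]
      by_cases h : b ∈ T <;> simp only [h]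
      · exact (card_powersetCard_filter_mem u).2.2.2.1
      · exact (card_powersetCard_filter_mem u).2.2.2.2
    · refine prod_congr rfl fun a ha => ?_
      have hab : a ≠ b := fun h => hb' (h ▸ ha)
      simp only [mem_sdiff, mem_erase, not_and] at ha
      simp only [pairSingle, hab, ha.1, ha.2 hab, if_true, if_false]
      exact (card_powersetCard_filter_mem u).2.2.1
  · intro a _ ha
    simp only [mem_insert, mem_sdiff, mem_erase, not_or, not_and] at ha
    obtain ⟨hab, ha⟩ := ha
    by_cases h : a ∈ B
    · have h1 : a ∈ T := by tauto
      simp only [pairSingle, hab, h, h1, if_true, if_false]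
      exact (card_powersetCard_filter_mem u).2.1
    · have h1 : a ∉ T := fun h' => h (hT' (mem_erase.2 ⟨hab, h'⟩))
      simp only [pairSingle, hab, h, h1, if_false]
      exact (card_powersetCard_filter_mem u).1

theorem card_of_mem_withProfile {m : Fin r → ℕ} {s : Finset (Card r)} (hs : s ∈ withProfile m) :
    s.card = ∑ a, m a := by
  rw [← sum_rankCount]
  exact sum_congr rfl fun a _ => mem_withProfile.1 hs a

theorem sum_single (B : Finset (Fin r)) : ∑ a, single B a = B.card := by
  simp [single]

theorem pairSingle_eq (b : Fin r) (B : Finset (Fin r)) (hb : b ∉ B) (a : Fin r) :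
    pairSingle b B a = (if a = b then 2 else 0) + single B a := by
  unfold pairSingle single
  split_ifs <;> simp_all

theorem sum_pairSingle (b : Fin r) (B : Finset (Fin r)) (hb : b ∉ B) :
    ∑ a, pairSingle b B a = 2 + B.card := by
  simp [pairSingle_eq b B hb, sum_add_distrib, sum_single]

theorem card_single (B : Finset (Fin r)) : (withProfile (single B)).card = 4 ^ B.card := by
  rw [withProfile, card_profile]
  have h : ∀ a, Nat.choose 4 (single B a) = if a ∈ B then 4 else 1 := by
    intro a
    unfold single
    split_ifs <;> rfl
  simp only [h, prod_ite_mem, univ_inter, prod_const]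

theorem card_pairSingle (b : Fin r) (B : Finset (Fin r)) (hb : b ∉ B) :
    (withProfile (pairSingle b B)).card = 6 * 4 ^ B.card := by
  rw [withProfile, card_profile]
  have h : ∀ a, Nat.choose 4 (pairSingle b B a) =
      (if a = b then 6 else 1) * (if a ∈ B then 4 else 1) := by
    intro a
    unfold pairSingle
    split_ifs <;> simp_all
    rfl
  simp only [h, prod_mul_distrib, prod_ite_mem, univ_inter, prod_const, prod_ite_eq', mem_univ,
    if_true]

/-- `15540 = 4 ^ 7 - 4 * 211`, where `211 = 21 * 9 + 7 * 3 + 1` counts the patterns with 5, 6 or 7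
cards of a given suit. -/
theorem card_single_flushFree {B : Finset (Fin r)} (hB : B.card = 7) :
    ((withProfile (single B)).filter FlushFree).card = 15540 := by
  have h1 := card_filter_flushFree (withProfile (single B)) fun s hs => by
    rw [card_of_mem_withProfile hs, sum_single, hB]
  have h2 : ∀ u, ((withProfile (single B)).filter fun s => 5 ≤ (ofSuit s u).card).card = 211 := by
    intro u
    rw [card_withProfile_flush (single B) u B (fun a ha => by simp [single, ha]) _
      (fun T hT => card_single_suitRanks B u hT),
      sum_powerset_apply_card (fun n => if 5 ≤ n then 3 ^ (B.card - n) else 0), hB]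
    decide
  rw [sum_congr rfl (fun u _ => h2 u), card_single, hB] at h1
  simpa using h1

/-- `5940 = 6 * 4 ^ 5 - 4 * 51`. For a given suit, `51 = 3 + 45 + 3`: five singles without the pair,
four singles with the pair, and five singles with the pair. -/
theorem card_pairSingle_flushFree {b : Fin r} {B : Finset (Fin r)} (hb : b ∉ B)
    (hB : B.card = 5) :
    ((withProfile (pairSingle b B)).filter FlushFree).card = 5940 := by
  have h1 := card_filter_flushFree (withProfile (pairSingle b B)) fun s hs => by
    rw [card_of_mem_withProfile hs, sum_pairSingle b B hb, hB]
  have h2 : ∀ u, ((withProfile (pairSingle b B)).filter fun s =>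
      5 ≤ (ofSuit s u).card).card = 51 := by
    intro u
    rw [card_withProfile_flush (pairSingle b B) u (insert b B) (fun a ha => by
      simp only [mem_insert, not_or] at ha
      simp [pairSingle, ha.1, ha.2]) _ (fun T hT => card_pairSingle_suitRanks b B hb u hT),
      sum_powerset_insert hb]
    have e1 : ∀ T ∈ B.powerset, (if 5 ≤ T.card then 3 * 3 ^ (B.card - (T.erase b).card) else 0) =
        (fun n => if 5 ≤ n then 3 * 3 ^ (B.card - n) else 0) T.card := by
      intro T hT
      rw [erase_eq_of_notMem (fun h => hb (mem_powerset.1 hT h))]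
    have e2 : ∀ T ∈ B.powerset, (if 5 ≤ (insert b T).card then
        3 * 3 ^ (B.card - ((insert b T).erase b).card) else 0) =
        (fun n => if 5 ≤ n + 1 then 3 * 3 ^ (B.card - n) else 0) T.card := by
      intro T hT
      have h : b ∉ T := fun h => hb (mem_powerset.1 hT h)
      rw [erase_insert h, card_insert_of_notMem h]
    rw [sum_congr rfl e1, sum_congr rfl e2,
      sum_powerset_apply_card (fun n => if 5 ≤ n then 3 * 3 ^ (B.card - n) else 0),
      sum_powerset_apply_card (fun n => if 5 ≤ n + 1 then 3 * 3 ^ (B.card - n) else 0), hB]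
    decide
  rw [sum_congr rfl (fun u _ => h2 u), card_pairSingle b B hb, hB] at h1
  simpa using h1

theorem rankCount_mem_of_ofType {s : Finset (Card r)} {j k : ℕ} (hs : s ∈ ofType r 0 0 j k)
    (a : Fin r) : rankCount s a ≤ 2 := by
  rw [mem_ofType] at hs
  have h1 := rankCount_le_four s a
  have h2 : 0 < (ranksWith s (rankCount s a)).card := card_pos.2 ⟨a, mem_ranksWith.2 rfl⟩
  interval_cases rankCount s a <;> omega

theorem mem_single_iff {s : Finset (Card r)} {B : Finset (Fin r)} :
    s ∈ withProfile (single B) ↔ s ∈ ofType r 0 0 0 B.card ∧ ranks s = B := by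
  constructor
  · intro hs
    have h := mem_withProfile.1 hs
    have h1 : ranksWith s 4 = ∅ ∧ ranksWith s 3 = ∅ ∧ ranksWith s 2 = ∅ ∧ ranksWith s 1 = B := by
      refine ⟨?_, ?_, ?_, ?_⟩ <;>
      · ext a
        rw [mem_ranksWith, h a]
        unfold single
        split_ifs <;> simp_all
    refine ⟨by simp [mem_ofType, h1], ?_⟩
    ext a
    rw [mem_ranks, h a]
    unfold single
    split_ifs <;> simp_all
  · rintro ⟨hs, rfl⟩
    refine mem_withProfile.2 fun a => ?_
    have h1 := rankCount_mem_of_ofType hs a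
    have h2 : a ∉ ranksWith s 2 := by
      rw [card_eq_zero.1 (mem_ofType.1 hs).2.2.1]
      exact notMem_empty a
    rw [mem_ranksWith] at h2
    unfold single
    simp only [mem_ranks]
    split_ifs <;> omega

theorem mem_pairSingle_iff {s : Finset (Card r)} {b : Fin r} {B : Finset (Fin r)} (hb : b ∉ B) :
    s ∈ withProfile (pairSingle b B) ↔ s ∈ ofType r 0 0 1 B.card ∧ ranksWith s 2 = {b} ∧
      ranks s = insert b B := by
  constructor
  · intro hs
    have h := mem_withProfile.1 hs
    have h1 : ranksWith s 4 = ∅ ∧ ranksWith s 3 = ∅ ∧ ranksWith s 2 = {b} ∧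
        ranksWith s 1 = B := by
      refine ⟨?_, ?_, ?_, ?_⟩ <;>
      · ext a
        rw [mem_ranksWith, h a]
        unfold pairSingle
        split_ifs <;> simp_all
    refine ⟨by simp [mem_ofType, h1], h1.2.2.1, ?_⟩
    ext a
    rw [mem_ranks, h a]
    unfold pairSingle
    split_ifs <;> simp_all
  · rintro ⟨hs, h2, h3⟩
    refine mem_withProfile.2 fun a => ?_
    have h1 := rankCount_mem_of_ofType hs a
    have h4 : a ∈ ranksWith s 2 ↔ a = b := by rw [h2, mem_singleton]
    have h5 : a ∈ ranks s ↔ a = b ∨ a ∈ B := by rw [h3, mem_insert]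
    rw [mem_ranksWith] at h4
    rw [mem_ranks] at h5
    unfold pairSingle
    split_ifs with h6 h7
    · exact h4.2 h6
    · have := h5.2 (.inr h7)
      have := mt h4.1 h6
      omega
    · have := mt h5.1 (by tauto)
      omega

theorem card_ofType_single_filter (p : Finset (Card r) → Prop) [DecidablePred p] {k c : ℕ}
    (hc : ∀ B : Finset (Fin r), B.card = k → ((withProfile (single B)).filter p).card = c)
    (S : Finset (Finset (Fin r))) (hS : ∀ B ∈ S, B.card = k) :
    ((ofType r 0 0 0 k).filter fun s => ranks s ∈ S ∧ p s).card = S.card * c := by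
  rw [card_eq_sum_card_fiberwise (f := ranks) (t := S) fun s hs => (mem_filter.1 hs).2.1,
    sum_const_nat]
  intro B hB
  rw [← hc B (hS B hB), filter_filter]
  congr 1
  ext s
  simp only [mem_filter, mem_single_iff, hS B hB]
  constructor
  · rintro ⟨h1, ⟨-, h2⟩, h3⟩
    exact ⟨⟨h1, h3⟩, h2⟩
  · rintro ⟨⟨h1, h2⟩, h3⟩
    exact ⟨h1, ⟨h2 ▸ hB, h3⟩, h2⟩

/-- Over a fixed set of `k + 1` ranks, the fibres are indexed by the rank that is paired, whence the
factor `k + 1`. -/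
theorem card_ofType_pair_filter (p : Finset (Card r) → Prop) [DecidablePred p] {k c : ℕ}
    (hc : ∀ (b : Fin r) (B : Finset (Fin r)), b ∉ B → B.card = k →
      ((withProfile (pairSingle b B)).filter p).card = c)
    (S : Finset (Finset (Fin r))) (hS : ∀ B ∈ S, B.card = k + 1) :
    ((ofType r 0 0 1 k).filter fun s => ranks s ∈ S ∧ p s).card = S.card * ((k + 1) * c) := by
  rw [card_eq_sum_card_fiberwise (f := ranks) (t := S) fun s hs => (mem_filter.1 hs).2.1,
    sum_const_nat]
  intro B hB
  have hmap : ∀ s ∈ ((ofType r 0 0 1 k).filter fun s => ranks s ∈ S ∧ p s).filter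
      fun s => ranks s = B, ranksWith s 2 ∈ B.image fun b => ({b} : Finset (Fin r)) := by
    intro s hs
    simp only [mem_filter] at hs
    obtain ⟨b, h1⟩ := card_eq_one.1 (mem_ofType.1 hs.1.1).2.2.1
    refine mem_image.2 ⟨b, ?_, h1.symm⟩
    have h2 : b ∈ ranksWith s 2 := h1 ▸ mem_singleton_self b
    rw [← hs.2, mem_ranks, mem_ranksWith.1 h2]
    norm_num
  rw [card_eq_sum_card_fiberwise hmap, sum_const_nat (m := c), card_image_of_injective _
    singleton_injective, hS B hB]
  intro x hx
  obtain ⟨b, hb, rfl⟩ := mem_image.1 hx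
  have hk : (B.erase b).card = k := by rw [card_erase_of_mem hb, hS B hB]; rfl
  rw [← hc b (B.erase b) (notMem_erase b B) hk, filter_filter, filter_filter]
  congr 1
  ext s
  simp only [mem_filter, mem_pairSingle_iff (notMem_erase b B), hk, insert_erase hb]
  constructor
  · rintro ⟨h1, ⟨-, h2⟩, h3, h4⟩
    exact ⟨⟨h1, h4, h3⟩, h2⟩
  · rintro ⟨⟨h1, h4, h3⟩, h2⟩
    exact ⟨h1, ⟨h3 ▸ hB, h2⟩, h3, h4⟩

theorem mem_sevenCardHands {s : Finset (Card r)} : s ∈ sevenCardHands r ↔ s.card = 7 := by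
  simp [sevenCardHands, mem_powersetCard]

/-! ### Straight-free sets of ranks. -/

open Classical in
/-- The sets of `n` ranks which contain no straight. -/
noncomputable def straightFree (r n : ℕ) : Finset (Finset (Fin r)) :=
  (powersetCard n univ).filter fun B => ¬ HasStraight B

theorem mem_straightFree {n : ℕ} {B : Finset (Fin r)} :
    B ∈ straightFree r n ↔ B.card = n ∧ ¬ HasStraight B := by
  simp [straightFree, mem_powersetCard]

/-- Double counting of inclusions: every `n`-subset of a straight-free set is straight-free, while
an `n`-set has only `r - n` one-element extensions. -/
theorem card_straightFree_succ_mul_le (r n : ℕ) :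
    (straightFree r (n + 1)).card * (n + 1) ≤ (straightFree r n).card * (r - n) := by
  classical
  refine card_mul_le_card_mul (fun B A => A ⊆ B) ?_ ?_
  · intro B hB
    rw [mem_straightFree] at hB
    rw [← hB.1]
    refine card_le_card_of_injOn (fun b => B.erase b) ?_ ?_
    · intro b hb
      rw [mem_coe, mem_bipartiteAbove, mem_straightFree, card_erase_of_mem hb, hB.1]
      exact ⟨⟨rfl, fun h => hB.2 (h.mono (erase_subset _ _))⟩, erase_subset _ _⟩
    · exact erase_injOn B
  · intro A hA
    rw [mem_straightFree] at hA
    have h : (Aᶜ.image fun b => insert b A).card ≤ r - n := by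
      refine card_image_le.trans ?_
      rw [card_compl, hA.1, Fintype.card_fin]
    refine le_trans (card_le_card ?_) h
    intro B hB
    rw [mem_bipartiteBelow, mem_straightFree] at hB
    obtain ⟨⟨h1, -⟩, h2⟩ := hB
    have h3 : (B \ A).card = 1 := by rw [card_sdiff_of_subset h2, h1, hA.1]; omega
    obtain ⟨b, hb⟩ := card_eq_one.1 h3
    refine mem_image.2 ⟨b, ?_, ?_⟩
    · have : b ∈ B \ A := hb ▸ mem_singleton_self b
      simpa using (mem_sdiff.1 this).2
    · rw [insert_eq, ← hb, sdiff_union_of_subset h2]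

theorem card_of_mem_ofType {s : Finset (Card r)} {l i j k : ℕ} (hs : s ∈ ofType r l i j k) :
    s.card = 4 * l + 3 * i + 2 * j + k := by
  rw [mem_ofType] at hs
  rw [card_of_types, hs.1, hs.2.1, hs.2.2.1, hs.2.2.2]

theorem card_singles_flushFree_straightFree (r : ℕ) :
    ((ofType r 0 0 0 7).filter fun s => ranks s ∈ straightFree r 7 ∧ FlushFree s).card =
      (straightFree r 7).card * 15540 :=
  card_ofType_single_filter FlushFree (fun _ hB => card_single_flushFree hB) _
    fun _ hB => (mem_straightFree.1 hB).1

theorem card_pair_flushFree_straightFree (r : ℕ) :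
    ((ofType r 0 0 1 5).filter fun s => ranks s ∈ straightFree r 6 ∧ FlushFree s).card =
      (straightFree r 6).card * 35640 :=
  card_ofType_pair_filter FlushFree (fun _ _ hb hB => card_pairSingle_flushFree hb hB) _
    fun _ hB => (mem_straightFree.1 hB).1

/-! ### The rankings differ for `r ≤ 22`. -/

theorem freq_le_freq_HC (r : ℕ) (h : HandType) : freq r h ≤ freq r .HC := by
  classical
  unfold freq
  refine card_le_card fun s hs => ?_
  rw [mem_filter] at hs ⊢
  exact ⟨hs.1, contains_HC (mem_sevenCardHands.1 hs.1)⟩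

theorem freq_lt_freq_HC {s : Finset (Card r)} (hs : s.card = 7) {h : HandType}
    (hh : ¬ Contains s h) : freq r h < freq r .HC := by
  classical
  unfold freq
  refine card_lt_card ((ssubset_iff_of_subset fun t ht => ?_).2 ⟨s, ?_, ?_⟩)
  · rw [mem_filter] at ht ⊢
    exact ⟨ht.1, contains_HC (mem_sevenCardHands.1 ht.1)⟩
  · exact mem_filter.2 ⟨mem_sevenCardHands.2 hs, contains_HC hs⟩
  · exact fun h => hh (mem_filter.1 h).2

theorem ofType_nonempty {l i j k : ℕ} (h : l + i + j + k ≤ r) : (ofType r l i j k).Nonempty := by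
  rw [← card_pos, card_ofType]
  have h1 := Nat.choose_pos (n := r) (k := l) (by omega)
  have h2 := Nat.choose_pos (n := r - l) (k := i) (by omega)
  have h3 := Nat.choose_pos (n := r - l - i) (k := j) (by omega)
  have h4 := Nat.choose_pos (n := r - l - i - j) (k := k) (by omega)
  positivity

theorem freq_ST_lt (hr : 5 ≤ r) : freq r .ST < freq r .HC := by
  obtain ⟨s, hs⟩ := ofType_nonempty (r := r) (l := 1) (i := 1) (j := 0) (k := 0) (by omega)
  refine freq_lt_freq_HC (card_of_mem_ofType hs) fun h => ?_
  have := contains_ST_imp_card h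
  have := mem_ofType.1 hs
  omega

theorem freq_FL_lt (hr : 5 ≤ r) : freq r .FL < freq r .HC := by
  obtain ⟨s, hs⟩ := ofType_nonempty (r := r) (l := 1) (i := 1) (j := 0) (k := 0) (by omega)
  refine freq_lt_freq_HC (card_of_mem_ofType hs) fun h => ?_
  have := contains_FL_imp_card h
  have := mem_ofType.1 hs
  omega

theorem freq_P2_lt (hr : 5 ≤ r) : freq r .P2 < freq r .HC := by
  obtain ⟨s, hs⟩ := ofType_nonempty (r := r) (l := 0) (i := 1) (j := 0) (k := 4) (by omega)
  refine freq_lt_freq_HC (card_of_mem_ofType hs) fun h => ?_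
  have := (contains_P2_iff_card (card_of_mem_ofType hs)).1 h
  have := mem_ofType.1 hs
  omega

theorem freq_X3_lt (hr : 5 ≤ r) : freq r .X3 < freq r .HC := by
  obtain ⟨s, hs⟩ := ofType_nonempty (r := r) (l := 0) (i := 0) (j := 2) (k := 3) (by omega)
  refine freq_lt_freq_HC (card_of_mem_ofType hs) fun h => ?_
  have := (contains_X3_iff_card (card_of_mem_ofType hs)).1 h
  have := mem_ofType.1 hs
  omega

theorem freq_P1_lt (hr : 7 ≤ r) : freq r .P1 < freq r .HC := by
  obtain ⟨s, hs⟩ := ofType_nonempty (r := r) (l := 0) (i := 0) (j := 0) (k := 7) (by omega)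
  refine freq_lt_freq_HC (card_of_mem_ofType hs) fun h => ?_
  have := (contains_P1_iff_card (card_of_mem_ofType hs)).1 h
  have := mem_ofType.1 hs
  omega

theorem hasStraight_univ (hr : 5 ≤ r) : HasStraight (univ : Finset (Fin r)) := by
  refine ⟨univ.filter fun a => (a : ℕ) < 5, subset_univ _, ?_⟩
  have h : (univ.filter fun a : Fin r => (a : ℕ) < 5).map Fin.valEmbedding = Ico 0 (0 + 5) := by
    ext n
    simp only [mem_map, mem_filter, mem_univ, true_and, Fin.valEmbedding_apply, mem_Ico]
    constructor
    · rintro ⟨a, h, rfl⟩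
      omega
    · exact fun h => ⟨⟨n, by omega⟩, by simpa using h, rfl⟩
  refine ⟨?_, .inl ⟨0, h⟩⟩
  rw [← card_map Fin.valEmbedding, h]
  rfl

/-- Without two pair and three of a kind, seven cards occupy at least six ranks. With `r ≤ 6` these
can only be all ranks, which contain a straight. -/
theorem showdownFreq_HC_of_le_six (hr : 5 ≤ r) (hr' : r ≤ 6) :
    showdownFreq r (freqRanking r) .HC = 0 := by
  classical
  unfold showdownFreq
  rw [card_eq_zero, filter_eq_empty_iff]
  rintro s hs ⟨-, h⟩
  rw [mem_sevenCardHands] at hs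
  have h1 := h .P2 (freq_P2_lt hr)
  have h2 := h .X3 (freq_X3_lt hr)
  have h3 := h .ST (freq_ST_lt hr)
  rw [contains_P2_iff_card hs] at h1
  rw [contains_X3_iff_card hs] at h2
  have h4 := card_ranks_eq s
  have h5 := card_of_types s
  have h6 : (ranks s).card ≤ r := card_finset_fin_le _
  have h7 : ranks s = univ := by
    rw [← card_eq_iff_eq_univ, Fintype.card_fin]
    omega
  exact h3 (contains_ST_iff.2 (h7 ▸ hasStraight_univ hr))

theorem showdownFreq_HC_le (hr : 7 ≤ r) :
    showdownFreq r (freqRanking r) .HC ≤ (straightFree r 7).card * 15540 := by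
  classical
  rw [← card_singles_flushFree_straightFree]
  unfold showdownFreq
  refine card_le_card fun s hs => ?_
  rw [mem_filter, mem_sevenCardHands] at hs
  obtain ⟨h7, -, h⟩ := hs
  have h1 := h .P1 (freq_P1_lt hr)
  have h2 := h .ST (freq_ST_lt (by omega))
  have h3 := h .FL (freq_FL_lt (by omega))
  rw [contains_P1_iff_card h7] at h1
  have h4 := card_of_types s
  have h5 := card_ranks_eq s
  rw [mem_filter, mem_ofType, mem_straightFree, ← contains_ST_iff, ← not_contains_FL_iff]
  refine ⟨⟨?_, ?_, ?_, ?_⟩, ⟨?_, h2⟩, h3⟩ <;> omega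

/-- The hands counted contain only HC and P1, and HC is never ranked above P1; so no knowledge of
the rest of the frequency ranking is needed. -/
theorem le_showdownFreq_P1 (r : ℕ) :
    (straightFree r 6).card * 35640 ≤ showdownFreq r (freqRanking r) .P1 := by
  classical
  rw [← card_pair_flushFree_straightFree]
  unfold showdownFreq
  refine card_le_card fun s hs => ?_
  rw [mem_filter, mem_straightFree, ← contains_ST_iff, ← not_contains_FL_iff] at hs
  obtain ⟨h1, ⟨-, h2⟩, h3⟩ := hs
  have h7 : s.card = 7 := card_of_mem_ofType h1
  rw [mem_ofType] at h1
  rw [mem_filter, mem_sevenCardHands, contains_P1_iff_card h7]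
  refine ⟨h7, by omega, fun h' hlt => ?_⟩
  cases h' with
  | HC => exact absurd hlt (freq_le_freq_HC r .P1).not_gt
  | P1 => exact absurd hlt (lt_irrefl _)
  | P2 => rw [contains_P2_iff_card h7]; omega
  | X3 => rw [contains_X3_iff_card h7]; omega
  | ST => exact h2
  | FL => exact h3
  | FH => rw [contains_FH_iff_card h7]; omega
  | X4 => rw [contains_X4_iff_card h7]; omega
  | SF => exact fun h => h2 (contains_SF_imp h).1

theorem showdownRanking_ne_freqRanking (hr : 5 ≤ r) (hr' : r ≤ 22) :
    showdownRanking r ≠ freqRanking r := by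
  intro heq
  rcases Nat.lt_or_ge r 7 with h | h
  · have h1 : showdownRanking r .X3 .HC := by
      rw [heq]
      exact freq_X3_lt hr
    unfold showdownRanking at h1
    rw [showdownFreq_HC_of_le_six hr (by omega)] at h1
    omega
  · have h1 : showdownRanking r .P1 .HC := by
      rw [heq]
      exact freq_P1_lt h
    unfold showdownRanking at h1
    have h2 := showdownFreq_HC_le h
    have h3 := le_showdownFreq_P1 r
    have h4 : (straightFree r 7).card * 7 ≤ (straightFree r 6).card * (r - 6) :=
      card_straightFree_succ_mul_le r 6
    have h5 : (straightFree r 6).card * (r - 6) ≤ (straightFree r 6).card * 16 :=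
      Nat.mul_le_mul_left _ (by omega)
    -- The margin is `15540 / 7 * 16 = 35520 ≤ 35640`; it would be lost with 17 in place of 16, that
    -- is, at `r = 23`.
    omega

/-! ### Upper bounds for the frequencies. -/

/-- Union bound: each good `s` is a witness `t` together with `n - m` further elements, and hands
with several witnesses are overcounted. -/
theorem card_filter_exists_subset_le {α : Type*} [Fintype α] [DecidableEq α]
    (T : Finset (Finset α)) (m n : ℕ) (p : Finset α → Prop) [DecidablePred p]
    (hp : ∀ s, s.card = n → p s → ∃ t ∈ T, t.card = m ∧ t ⊆ s) :
    ((powersetCard n univ).filter p).card ≤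
      T.card * (Fintype.card α - m).choose (n - m) := by
  have h1 : (powersetCard n univ).filter p ⊆ (T.filter fun t => t.card = m).biUnion fun t =>
      (powersetCard (n - m) tᶜ).image fun x => t ∪ x := by
    intro s hs
    rw [mem_filter, mem_powersetCard] at hs
    obtain ⟨t, h1, h2, h3⟩ := hp s hs.1.2 hs.2
    refine mem_biUnion.2 ⟨t, mem_filter.2 ⟨h1, h2⟩, mem_image.2 ⟨s \ t, ?_, ?_⟩⟩
    · rw [mem_powersetCard, card_sdiff_of_subset h3, hs.1.2, h2]
      exact ⟨fun x hx => mem_compl.2 (mem_sdiff.1 hx).2, rfl⟩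
    · exact union_sdiff_of_subset h3
  refine (card_le_card h1).trans ((card_biUnion_le_card_mul _ _
    ((Fintype.card α - m).choose (n - m)) ?_).trans
      (Nat.mul_le_mul_right _ (card_filter_le _ _)))
  intro t ht
  refine card_image_le.trans_eq ?_
  rw [card_powersetCard, card_compl, (mem_filter.1 ht).2]

theorem card_sevenCardHands_filter_le (T : Finset (Finset (Card r))) (m : ℕ)
    (p : Finset (Card r) → Prop) [DecidablePred p]
    (hp : ∀ s, s.card = 7 → p s → ∃ t ∈ T, t.card = m ∧ t ⊆ s) :
    ((sevenCardHands r).filter p).card ≤ T.card * (r * 4 - m).choose (7 - m) := by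
  have h := card_filter_exists_subset_le T m 7 p hp
  rwa [Fintype.card_prod, Fintype.card_fin, Fintype.card_fin] at h

theorem exists_product_subset {s : Finset (Card r)} {a : Fin r} {k : ℕ}
    (h : k ≤ rankCount s a) : ∃ P ∈ powersetCard k (univ : Finset (Fin 4)), {a} ×ˢ P ⊆ s := by
  rw [← card_slice] at h
  obtain ⟨P, h1, h2⟩ := exists_subset_card_eq h
  refine ⟨P, mem_powersetCard.2 ⟨subset_univ _, h2⟩, ?_⟩
  rintro ⟨b, u⟩ hb
  rw [mem_product, mem_singleton] at hb
  obtain ⟨rfl, hu⟩ := hb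
  exact mem_slice.1 (h1 hu)

theorem card_filter_exists_rankCount_le (r k : ℕ) :
    ((sevenCardHands r).filter fun s => ∃ a, k ≤ rankCount s a).card ≤
      (r * Nat.choose 4 k) * (r * 4 - k).choose (7 - k) := by
  let T : Finset (Finset (Card r)) :=
    ((univ : Finset (Fin r)) ×ˢ powersetCard k (univ : Finset (Fin 4))).image
      fun x => {x.1} ×ˢ x.2
  have hT : T.card ≤ r * Nat.choose 4 k := by
    refine card_image_le.trans_eq ?_
    simp
  refine (card_sevenCardHands_filter_le T k _ ?_).trans (Nat.mul_le_mul_right _ hT)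
  rintro s - ⟨a, ha⟩
  obtain ⟨P, h1, h2⟩ := exists_product_subset ha
  refine ⟨{a} ×ˢ P, mem_image.2 ⟨(a, P), by simpa using h1, rfl⟩, ?_, h2⟩
  rw [card_product, card_singleton, (mem_powersetCard.1 h1).2, one_mul]

theorem card_filter_exists_two_rankCount_le (r i j : ℕ) :
    ((sevenCardHands r).filter fun s =>
      ∃ a b, a ≠ b ∧ i ≤ rankCount s a ∧ j ≤ rankCount s b).card ≤
      (r * Nat.choose 4 i * (r * Nat.choose 4 j)) * (r * 4 - (i + j)).choose (7 - (i + j)) := by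
  -- Coinciding ranks and both orders of the two ranks are allowed, which only enlarges the bound.
  let T : Finset (Finset (Card r)) :=
    (((univ : Finset (Fin r)) ×ˢ powersetCard i (univ : Finset (Fin 4))) ×ˢ
      ((univ : Finset (Fin r)) ×ˢ powersetCard j (univ : Finset (Fin 4)))).image
      fun x => {x.1.1} ×ˢ x.1.2 ∪ {x.2.1} ×ˢ x.2.2
  have hT : T.card ≤ r * Nat.choose 4 i * (r * Nat.choose 4 j) := by
    refine card_image_le.trans_eq ?_
    simp
  refine (card_sevenCardHands_filter_le T (i + j) _ ?_).trans (Nat.mul_le_mul_right _ hT)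
  rintro s - ⟨a, b, hab, ha, hb⟩
  obtain ⟨P, h1, h2⟩ := exists_product_subset ha
  obtain ⟨Q, h3, h4⟩ := exists_product_subset hb
  refine ⟨{a} ×ˢ P ∪ {b} ×ˢ Q, mem_image.2 ⟨((a, P), (b, Q)), ?_, rfl⟩, ?_, union_subset h2 h4⟩
  · simp only [mem_product, mem_univ, true_and]
    exact ⟨h1, h3⟩
  · rw [card_union_of_disjoint, card_product, card_product, card_singleton, card_singleton,
      (mem_powersetCard.1 h1).2, (mem_powersetCard.1 h3).2, one_mul, one_mul]
    rw [disjoint_left]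
    rintro ⟨c, u⟩ hc hc'
    simp only [mem_product, mem_singleton] at hc hc'
    exact hab (hc.1.symm.trans hc'.1)

open Classical in
/-- The sets of five ranks which form a straight. -/
noncomputable def straights (r : ℕ) : Finset (Finset (Fin r)) :=
  univ.filter IsStraightRanks

theorem mem_straights {R : Finset (Fin r)} : R ∈ straights r ↔ IsStraightRanks R := by
  simp [straights]

/-- There are `r - 4` intervals, and one more straight with the ace low. -/
theorem card_straights_le (hr : 5 ≤ r) : (straights r).card ≤ r - 3 := by
  have h1 : (straights r).image (fun R => R.map Fin.valEmbedding) ⊆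
      insert (insert (r - 1) (range 4)) ((range (r - 4)).image fun k => Ico k (k + 5)) := by
    intro x hx
    obtain ⟨R, hR, rfl⟩ := mem_image.1 hx
    rw [mem_insert, mem_image]
    rcases (mem_straights.1 hR).2 with ⟨k, hk⟩ | h
    · refine .inr ⟨k, ?_, hk.symm⟩
      have : k + 4 ∈ R.map Fin.valEmbedding := by
        rw [hk, mem_Ico]
        omega
      obtain ⟨a, -, ha⟩ := mem_map.1 this
      have := a.2
      rw [Fin.valEmbedding_apply] at ha
      rw [mem_range]
      omega
    · exact .inl h
  rw [← card_image_of_injective _ (map_injective Fin.valEmbedding)]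
  refine (card_le_card h1).trans ((card_insert_le _ _).trans ?_)
  have := card_image_le (s := range (r - 4)) (f := fun k => Ico k (k + 5))
  rw [card_range] at this
  omega

theorem card_filter_hasStraight_le (hr : 5 ≤ r) (n : ℕ) [DecidablePred (HasStraight (r := r))] :
    ((powersetCard n univ).filter (HasStraight (r := r))).card ≤
      (r - 3) * (r - 5).choose (n - 5) := by
  have h := card_filter_exists_subset_le (straights r) 5 n HasStraight
    fun s _ ⟨R, h1, h2⟩ => ⟨R, mem_straights.2 h2, h2.1, h1⟩
  rw [Fintype.card_fin] at h
  exact h.trans (Nat.mul_le_mul_right _ (card_straights_le hr))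

theorem freq_ST_le (hr : 5 ≤ r) :
    freq r .ST ≤ ((r - 3) * 4 ^ 5) * (r * 4 - 5).choose 2 := by
  classical
  have h1 : ((ofType r 0 0 0 5).filter fun s => ranks s ∈ straights r ∧ True).card =
      (straights r).card * 4 ^ 5 :=
    card_ofType_single_filter (fun _ => True) (fun B hB => by
      rw [filter_true, card_single, hB]) _ fun B hB => (mem_straights.1 hB).1
  refine (card_sevenCardHands_filter_le _ 5 _ ?_).trans (Nat.mul_le_mul_right _
    (h1.trans_le (Nat.mul_le_mul_right _ (card_straights_le hr))))
  rintro s - ⟨t, h2, h3, h4⟩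
  have h5 := (isStraight_iff t).1 h4
  refine ⟨t, mem_filter.2 ⟨?_, mem_straights.2 h5, trivial⟩, h3, h2⟩
  have h6 := h5.1
  have h7 := card_of_types t
  have h8 := card_ranks_eq t
  rw [mem_ofType]
  refine ⟨?_, ?_, ?_, ?_⟩ <;> omega

theorem freq_SF_le (hr : 5 ≤ r) :
    freq r .SF ≤ ((r - 3) * 4) * (r * 4 - 5).choose 2 := by
  classical
  let T : Finset (Finset (Card r)) :=
    (straights r ×ˢ (univ : Finset (Fin 4))).image fun x => x.1 ×ˢ {x.2}
  have hT : T.card ≤ (r - 3) * 4 := by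
    refine card_image_le.trans ?_
    rw [card_product, card_univ, Fintype.card_fin]
    exact Nat.mul_le_mul_right _ (card_straights_le hr)
  refine (card_sevenCardHands_filter_le T 5 _ ?_).trans (Nat.mul_le_mul_right _ hT)
  rintro s - ⟨t, h2, h3, h4, u, h5⟩
  refine ⟨t, mem_image.2 ⟨(ranks t, u), ?_, ?_⟩, h3, h2⟩
  · rw [mem_product]
    exact ⟨mem_straights.2 ((isStraight_iff t).1 h4), mem_univ _⟩
  · ext ⟨a, v⟩
    simp only [mem_product, mem_singleton, mem_ranks_iff]
    constructor
    · rintro ⟨⟨w, hw⟩, rfl⟩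
      rwa [← show w = v from h5 _ hw]
    · exact fun h => ⟨⟨v, h⟩, h5 _ h⟩

theorem freq_X4_le (r : ℕ) : freq r .X4 ≤ r * (r * 4 - 4).choose 3 := by
  classical
  refine le_trans (card_le_card ?_) ((card_filter_exists_rankCount_le r 4).trans_eq (by simp))
  intro s hs
  rw [mem_filter, mem_sevenCardHands] at *
  exact ⟨hs.1, (contains_X4_iff hs.1).1 hs.2⟩

theorem freq_X3_le (r : ℕ) : freq r .X3 ≤ (r * 4) * (r * 4 - 3).choose 4 := by
  classical
  refine le_trans (card_le_card ?_) (card_filter_exists_rankCount_le r 3)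
  intro s hs
  rw [mem_filter, mem_sevenCardHands] at *
  exact ⟨hs.1, (contains_X3_iff hs.1).1 hs.2⟩

theorem freq_FH_le (r : ℕ) : freq r .FH ≤ (r * 4 * (r * 6)) * (r * 4 - 5).choose 2 := by
  classical
  refine le_trans (card_le_card ?_) (card_filter_exists_two_rankCount_le r 3 2)
  intro s hs
  rw [mem_filter, mem_sevenCardHands] at *
  exact ⟨hs.1, (contains_FH_iff hs.1).1 hs.2⟩

theorem freq_P2_le (r : ℕ) : freq r .P2 ≤
    (r * 6 * (r * 6)) * (r * 4 - 4).choose 3 + r * (r * 4 - 4).choose 3 := by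
  classical
  refine le_trans (le_trans (card_le_card ?_) (card_union_le
    ((sevenCardHands r).filter fun s =>
      ∃ a b, a ≠ b ∧ 2 ≤ rankCount s a ∧ 2 ≤ rankCount s b)
    ((sevenCardHands r).filter fun s => Contains s .X4)))
    (add_le_add (card_filter_exists_two_rankCount_le r 2 2) (freq_X4_le r))
  intro s hs
  rw [mem_filter, mem_sevenCardHands] at hs
  rw [mem_union, mem_filter, mem_filter, mem_sevenCardHands, contains_X4_iff hs.1]
  rcases (contains_P2_iff hs.1).1 hs.2 with h | h
  · exact .inl ⟨hs.1, h⟩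
  · exact .inr ⟨hs.1, h⟩

theorem card_powersetCard_filter_card_filter {α : Type*} [Fintype α] [DecidableEq α]
    (p : α → Prop) [DecidablePred p] (n j : ℕ) (hj : j ≤ n) :
    ((powersetCard n univ).filter fun s : Finset α => (s.filter p).card = j).card =
      (univ.filter p).card.choose j * (univ.filter fun x => ¬ p x).card.choose (n - j) := by
  rw [← card_powersetCard, ← card_powersetCard, ← card_product]
  refine card_nbij' (fun s => (s.filter p, s.filter fun x => ¬ p x)) (fun x => x.1 ∪ x.2)
    ?_ ?_ ?_ ?_
  · intro s hs
    simp only [coe_filter, Set.mem_ofPred_eq, mem_powersetCard] at hs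
    have := card_filter_add_card_filter_not (s := s) p
    rw [mem_coe, mem_product, mem_powersetCard, mem_powersetCard]
    exact ⟨⟨filter_subset_filter _ (subset_univ _), hs.2⟩,
      filter_subset_filter _ (subset_univ _), by dsimp only; omega⟩
  · rintro ⟨x, y⟩ h
    rw [mem_coe, mem_product, mem_powersetCard, mem_powersetCard] at h
    obtain ⟨⟨h1, h2⟩, h3, h4⟩ := h
    dsimp only at h1 h2 h3 h4
    have h5 : ∀ c ∈ x, p c := fun c hc => (mem_filter.1 (h1 hc)).2
    have h6 : ∀ c ∈ y, ¬ p c := fun c hc => (mem_filter.1 (h3 hc)).2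
    have h7 : Disjoint x y := disjoint_left.2 fun c hc hc' => h6 c hc' (h5 c hc)
    rw [mem_coe, mem_filter, mem_powersetCard, card_union_of_disjoint h7, filter_union,
      filter_true_of_mem h5, filter_false_of_mem h6, union_empty]
    exact ⟨⟨subset_univ _, by omega⟩, h2⟩
  · intro s _
    exact filter_union_filter_not_eq _ _
  · rintro ⟨x, y⟩ h
    rw [mem_coe, mem_product, mem_powersetCard, mem_powersetCard] at h
    obtain ⟨⟨h1, h2⟩, h3, h4⟩ := h
    dsimp only at h1 h2 h3 h4
    have h5 : ∀ c ∈ x, p c := fun c hc => (mem_filter.1 (h1 hc)).2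
    have h6 : ∀ c ∈ y, ¬ p c := fun c hc => (mem_filter.1 (h3 hc)).2
    have h6' : ∀ c ∈ x, ¬ ¬ p c := fun c hc => not_not.2 (h5 c hc)
    simp only [filter_union, filter_true_of_mem h5, filter_false_of_mem h6,
      filter_false_of_mem h6', filter_true_of_mem h6, union_empty, empty_union]

theorem card_univ_ofSuit (r : ℕ) (u : Fin 4) :
    ((univ : Finset (Card r)).filter fun c => c.2 = u).card = r := by
  have h := card_suitRanks (univ : Finset (Card r)) u
  simpa [suitRanks, ofSuit] using h.symm

/-- Sorting by the number 5, 6 or 7 of cards in the flush suit. An exact value is used because FL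
enters the later comparisons both from above and from below, and the gap to P2 at `r = 23` is too
narrow for the union bound. -/
theorem freq_FL_eq (r : ℕ) : freq r .FL = 4 * (r.choose 5 * (r * 3).choose 2 +
    r.choose 6 * (r * 3) + r.choose 7) := by
  classical
  have h1 : freq r .FL =
      ((sevenCardHands r).filter fun s => ∃ u, 5 ≤ (ofSuit s u).card).card := by
    unfold freq
    simp only [contains_FL_iff]
  rw [h1, card_filter_exists_suit _ fun s hs => mem_sevenCardHands.1 hs]
  have h2 : ∀ u, ((sevenCardHands r).filter fun s => 5 ≤ (ofSuit s u).card).card =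
      r.choose 5 * (r * 3).choose 2 + r.choose 6 * (r * 3) + r.choose 7 := by
    intro u
    have h3 : (univ.filter fun c : Card r => ¬ c.2 = u).card = r * 3 := by
      have := card_filter_add_card_filter_not (s := (univ : Finset (Card r))) fun c => c.2 = u
      rw [card_univ_ofSuit, card_univ, Fintype.card_prod, Fintype.card_fin,
        Fintype.card_fin] at this
      omega
    have h4 : ∀ j ≤ 7, ((sevenCardHands r).filter fun s => (ofSuit s u).card = j).card =
        r.choose j * (r * 3).choose (7 - j) := by
      intro j hj
      have := card_powersetCard_filter_card_filter (fun c : Card r => c.2 = u) 7 j hj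
      rwa [h3, card_univ_ofSuit] at this
    have hmap : ∀ s ∈ (sevenCardHands r).filter fun s => 5 ≤ (ofSuit s u).card,
        (ofSuit s u).card ∈ Icc 5 7 := by
      intro s hs
      rw [mem_filter, mem_sevenCardHands] at hs
      exact mem_Icc.2 ⟨hs.2, hs.1 ▸ card_filter_le _ _⟩
    rw [card_eq_sum_card_fiberwise hmap]
    have h5 : ∀ j ∈ Icc 5 7, (((sevenCardHands r).filter fun s =>
        5 ≤ (ofSuit s u).card).filter fun s => (ofSuit s u).card = j).card =
        r.choose j * (r * 3).choose (7 - j) := by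
      intro j hj
      rw [mem_Icc] at hj
      rw [← h4 j hj.2, filter_filter]
      congr 1
      refine filter_congr fun s _ => ?_
      omega
    rw [sum_congr rfl h5, show Icc 5 7 = {5, 6, 7} from rfl]
    simp [add_assoc]
  rw [sum_congr rfl fun u _ => h2 u]
  simp

-- A flush together with a triple exhausts the seven cards: five in the flush suit, and two cards of
-- the triple's rank outside it.
open Classical in
theorem card_filter_FL_X3_le (r : ℕ) :
    ((sevenCardHands r).filter fun s => Contains s .FL ∧ Contains s .X3).card ≤
      r.choose 5 * 4 * (r * 6) := by
  let T : Finset (Finset (Card r)) :=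
    ((powersetCard 5 (univ : Finset (Fin r)) ×ˢ (univ : Finset (Fin 4))) ×ˢ
      ((univ : Finset (Fin r)) ×ˢ powersetCard 2 (univ : Finset (Fin 4)))).image
      fun x => x.1.1 ×ˢ {x.1.2} ∪ {x.2.1} ×ˢ x.2.2
  have hT : T.card ≤ r.choose 5 * 4 * (r * 6) := by
    refine card_image_le.trans_eq ?_
    simp [show Nat.choose 4 2 = 6 from rfl]
  refine (card_sevenCardHands_filter_le T 7 _ ?_).trans ?_
  · rintro s hs ⟨h1, h2⟩
    obtain ⟨u, hu⟩ := contains_FL_iff.1 h1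
    obtain ⟨a, ha⟩ := (contains_X3_iff hs).1 h2
    rw [← card_suitRanks] at hu
    obtain ⟨A, hA, hA'⟩ := exists_subset_card_eq hu
    -- At most one card of the triple has the flush suit.
    have h3 : 2 ≤ ((slice s a).erase u).card := by
      have := pred_card_le_card_erase (s := slice s a) (a := u)
      rw [card_slice] at this
      omega
    obtain ⟨P, hP, hP'⟩ := exists_subset_card_eq h3
    refine ⟨A ×ˢ {u} ∪ {a} ×ˢ P, mem_image.2 ⟨((A, u), (a, P)), ?_, rfl⟩, ?_, ?_⟩
    · simp [mem_powersetCard, hA', hP']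
    · rw [card_union_of_disjoint, card_product, card_product, card_singleton, card_singleton,
        hA', hP']
      rw [disjoint_left]
      rintro ⟨c, v⟩ hc hc'
      simp only [mem_product, mem_singleton] at hc hc'
      exact (mem_erase.1 (hP hc'.2)).1 hc.2
    · refine union_subset ?_ ?_
      · rintro ⟨c, v⟩ hc
        rw [mem_product, mem_singleton] at hc
        obtain ⟨hc, rfl⟩ := hc
        exact (mem_filter.1 (hA hc)).2
      · rintro ⟨c, v⟩ hc
        rw [mem_product, mem_singleton] at hc
        obtain ⟨rfl, hc⟩ := hc
        exact mem_slice.1 (mem_erase.1 (hP hc)).2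
  · simpa using hT

/-! ### Lower bounds valid for both frequencies and showdown frequencies. -/

open Classical in
/-- The number of sets of seven cards which contain `h` and no hand type in `l`. -/
noncomputable def countAvoiding (r : ℕ) (h : HandType) (l : List HandType) : ℕ :=
  ((sevenCardHands r).filter fun s => Contains s h ∧ ∀ h' ∈ l, ¬ Contains s h').card

theorem countAvoiding_le_freq (r : ℕ) (h : HandType) (l : List HandType) :
    countAvoiding r h l ≤ freq r h := by
  classical
  unfold countAvoiding freq
  refine card_le_card fun s hs => ?_
  rw [mem_filter] at *
  exact ⟨hs.1, hs.2.1⟩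

/-- Avoiding a list that includes every type ranked above `h` is the stronger condition. -/
theorem countAvoiding_le_showdownFreq {h : HandType} {l : List HandType}
    (hl : ∀ h', freq r h' < freq r h → h' ∈ l) :
    countAvoiding r h l ≤ showdownFreq r (freqRanking r) h := by
  classical
  unfold countAvoiding showdownFreq
  refine card_le_card fun s hs => ?_
  rw [mem_filter] at *
  exact ⟨hs.1, hs.2.1, fun h' h1 => hs.2.2 h' (hl h' h1)⟩

theorem showdownFreq_le_freq (r : ℕ) (rk : HandType → HandType → Prop) (h : HandType) :
    showdownFreq r rk h ≤ freq r h := by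
  classical
  unfold showdownFreq freq
  refine card_le_card fun s hs => ?_
  rw [mem_filter] at *
  exact ⟨hs.1, hs.2.1⟩

theorem card_le_countAvoiding (F : Finset (Finset (Card r))) {h : HandType} {l : List HandType}
    (hF : ∀ s ∈ F, s.card = 7 ∧ Contains s h ∧ ∀ h' ∈ l, ¬ Contains s h') :
    F.card ≤ countAvoiding r h l := by
  classical
  unfold countAvoiding
  refine card_le_card fun s hs => ?_
  rw [mem_filter, mem_sevenCardHands]
  exact hF s hs

-- Start from a family containing `h` and discard two exceptional events `p` and `q`, outside which
-- every type of `l` is avoided.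
open Classical in
theorem card_le_countAvoiding_add (F : Finset (Finset (Card r))) {h : HandType}
    {l : List HandType} (p q : Finset (Card r) → Prop)
    (hF : ∀ s ∈ F, s.card = 7 ∧ Contains s h ∧ (¬ p s → ¬ q s → ∀ h' ∈ l, ¬ Contains s h')) :
    F.card ≤ countAvoiding r h l + ((sevenCardHands r).filter p).card +
      ((sevenCardHands r).filter q).card := by
  unfold countAvoiding
  refine le_trans (card_le_card fun s hs => ?_) ((card_union_le _ _).trans
    (Nat.add_le_add_right (card_union_le _ _) _))
  obtain ⟨h1, h2, h3⟩ := hF s hs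
  simp only [mem_union, mem_filter, mem_sevenCardHands]
  by_cases hp : p s
  · tauto
  · by_cases hq : q s
    · tauto
    · exact .inl (.inl ⟨h1, h2, h3 hp hq⟩)

theorem le_countAvoiding_X4 (r : ℕ) :
    (ofType r 1 0 0 3).card ≤ countAvoiding r .X4 [.SF] := by
  refine card_le_countAvoiding _ fun s hs => ?_
  have h7 : s.card = 7 := card_of_mem_ofType hs
  rw [mem_ofType] at hs
  simp only [List.forall_mem_cons, List.not_mem_nil, false_imp_iff, implies_true, and_true]
  rw [contains_X4_iff_card h7]
  refine ⟨h7, by omega, fun h => ?_⟩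
  have := contains_ST_imp_card (contains_SF_imp h).1
  omega

theorem le_countAvoiding_FH (r : ℕ) :
    (ofType r 0 1 1 2).card ≤ countAvoiding r .FH [.SF, .X4] := by
  refine card_le_countAvoiding _ fun s hs => ?_
  have h7 : s.card = 7 := card_of_mem_ofType hs
  rw [mem_ofType] at hs
  simp only [List.forall_mem_cons, List.not_mem_nil, false_imp_iff, implies_true, and_true]
  rw [contains_FH_iff_card h7, contains_X4_iff_card h7]
  refine ⟨h7, by omega, fun h => ?_, by omega⟩
  have := contains_ST_imp_card (contains_SF_imp h).1
  omega

/-- A straight occupies five ranks, so two spare cards cannot make a full house or four of a kind;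
only SF has to be discarded. -/
theorem le_countAvoiding_ST (r : ℕ) :
    freq r .ST ≤ countAvoiding r .ST [.SF, .X4, .FH] + freq r .SF := by
  classical
  have h := card_le_countAvoiding_add ((sevenCardHands r).filter fun s => Contains s .ST)
    (h := .ST) (l := [.SF, .X4, .FH]) (fun s => Contains s .SF) (fun _ => False) ?_
  · rwa [filter_false, card_empty, add_zero] at h
  intro s hs
  rw [mem_filter, mem_sevenCardHands] at hs
  obtain ⟨h7, h1⟩ := hs
  have h2 := contains_ST_imp_card h1
  have h3 := card_of_types s
  refine ⟨h7, h1, fun h4 _ => ?_⟩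
  simp only [List.forall_mem_cons, List.not_mem_nil, false_imp_iff, implies_true, and_true]
  rw [contains_FH_iff_card h7, contains_X4_iff_card h7]
  exact ⟨h4, by omega, by omega⟩

theorem le_countAvoiding_X3 (r : ℕ) :
    (ofType r 0 1 0 4).card ≤ countAvoiding r .X3 [.SF, .X4, .FH, .ST] + freq r .ST := by
  classical
  have h := card_le_countAvoiding_add (ofType r 0 1 0 4)
    (h := .X3) (l := [.SF, .X4, .FH, .ST]) (fun s => Contains s .ST) (fun _ => False) ?_
  · rwa [filter_false, card_empty, add_zero] at h
  intro s hs
  have h7 : s.card = 7 := card_of_mem_ofType hs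
  rw [mem_ofType] at hs
  simp only [List.forall_mem_cons, List.not_mem_nil, false_imp_iff, implies_true, and_true]
  rw [contains_X3_iff_card h7, contains_FH_iff_card h7, contains_X4_iff_card h7]
  exact ⟨h7, by omega, fun h4 _ => ⟨fun h => h4 (contains_SF_imp h).1, by omega, by omega, h4⟩⟩

open Classical in
theorem le_countAvoiding_FL (r : ℕ) :
    freq r .FL ≤ countAvoiding r .FL [.SF, .X4, .FH, .ST, .X3] +
      ((sevenCardHands r).filter fun s => Contains s .FL ∧ Contains s .X3).card +
      freq r .ST := by
  have h := card_le_countAvoiding_add ((sevenCardHands r).filter fun s => Contains s .FL)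
    (h := .FL) (l := [.SF, .X4, .FH, .ST, .X3])
    (fun s => Contains s .FL ∧ Contains s .X3) (fun s => Contains s .ST) ?_
  · unfold freq
    convert h
  intro s hs
  rw [mem_filter, mem_sevenCardHands] at hs
  obtain ⟨h7, h1⟩ := hs
  refine ⟨h7, h1, fun h2 h3 => ?_⟩
  have h2' : ¬ Contains s .X3 := fun h => h2 ⟨h1, h⟩
  simp only [List.forall_mem_cons, List.not_mem_nil, false_imp_iff, implies_true, and_true]
  refine ⟨fun h => h3 (contains_SF_imp h).1, ?_, ?_, h3, h2'⟩ <;>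
    rw [contains_X3_iff_card h7] at h2'
  · rw [contains_X4_iff_card h7]
    omega
  · rw [contains_FH_iff_card h7]
    omega

theorem le_countAvoiding_P2 (r : ℕ) :
    (ofType r 0 0 2 3).card ≤ countAvoiding r .P2 [.SF, .X4, .FH, .ST, .X3, .FL] +
      freq r .ST + freq r .FL := by
  classical
  refine card_le_countAvoiding_add (ofType r 0 0 2 3)
    (fun s => Contains s .ST) (fun s => Contains s .FL) ?_
  intro s hs
  have h7 : s.card = 7 := card_of_mem_ofType hs
  rw [mem_ofType] at hs
  simp only [List.forall_mem_cons, List.not_mem_nil, false_imp_iff, implies_true, and_true]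
  rw [contains_P2_iff_card h7, contains_X3_iff_card h7, contains_FH_iff_card h7,
    contains_X4_iff_card h7]
  exact ⟨h7, by omega, fun h4 h5 =>
    ⟨fun h => h4 (contains_SF_imp h).1, by omega, by omega, h4, by omega, h5⟩⟩

theorem le_countAvoiding_P1 (r : ℕ) :
    (ofType r 0 0 1 5).card ≤ countAvoiding r .P1 [.SF, .X4, .FH, .ST, .X3, .FL, .P2] +
      freq r .ST + freq r .FL := by
  classical
  refine card_le_countAvoiding_add (ofType r 0 0 1 5)
    (fun s => Contains s .ST) (fun s => Contains s .FL) ?_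
  intro s hs
  have h7 : s.card = 7 := card_of_mem_ofType hs
  rw [mem_ofType] at hs
  simp only [List.forall_mem_cons, List.not_mem_nil, false_imp_iff, implies_true, and_true]
  rw [contains_P1_iff_card h7, contains_P2_iff_card h7, contains_X3_iff_card h7,
    contains_FH_iff_card h7, contains_X4_iff_card h7]
  exact ⟨h7, by omega, fun h4 h5 =>
    ⟨fun h => h4 (contains_SF_imp h).1, by omega, by omega, h4, by omega, h5, by omega⟩⟩

theorem le_countAvoiding_HC (r : ℕ) : (straightFree r 7).card * 15540 ≤
    countAvoiding r .HC [.SF, .X4, .FH, .ST, .X3, .FL, .P2, .P1] := by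
  rw [← card_singles_flushFree_straightFree]
  refine card_le_countAvoiding _ fun s hs => ?_
  rw [mem_filter, mem_straightFree, ← contains_ST_iff, ← not_contains_FL_iff] at hs
  obtain ⟨h1, ⟨-, h2⟩, h3⟩ := hs
  have h7 : s.card = 7 := card_of_mem_ofType h1
  rw [mem_ofType] at h1
  simp only [List.forall_mem_cons, List.not_mem_nil, false_imp_iff, implies_true, and_true]
  rw [contains_P1_iff_card h7, contains_P2_iff_card h7, contains_X3_iff_card h7,
    contains_FH_iff_card h7, contains_X4_iff_card h7]
  exact ⟨h7, contains_HC h7, fun h => h2 (contains_SF_imp h).1, by omega, by omega, h2,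
    by omega, h3, by omega, by omega⟩

/-- A pair without two pair or three of a kind fixes the multiplicities; straights and flushes need
not be removed for this bound. -/
theorem showdownFreq_P1_le (h2 : freq r .P2 < freq r .P1) (h3 : freq r .X3 < freq r .P1) :
    showdownFreq r (freqRanking r) .P1 ≤ (ofType r 0 0 1 5).card := by
  classical
  unfold showdownFreq
  refine card_le_card fun s hs => ?_
  rw [mem_filter, mem_sevenCardHands] at hs
  obtain ⟨h7, h4, h5⟩ := hs
  have h6 := h5 .P2 h2
  have h8 := h5 .X3 h3
  rw [contains_P1_iff_card h7] at h4
  rw [contains_P2_iff_card h7] at h6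
  rw [contains_X3_iff_card h7] at h8
  have h9 := card_of_types s
  rw [mem_ofType]
  refine ⟨?_, ?_, ?_, ?_⟩ <;> omega

/-! Straights among 23 ranks. -/

open Classical in
/-- The sets of `n` ranks which contain a straight. -/
noncomputable def withStraight (r n : ℕ) : Finset (Finset (Fin r)) :=
  (powersetCard n univ).filter HasStraight

theorem mem_withStraight {n : ℕ} {B : Finset (Fin r)} :
    B ∈ withStraight r n ↔ B.card = n ∧ HasStraight B := by
  simp [withStraight, mem_powersetCard]

theorem card_straightFree_add_card_withStraight (r n : ℕ) :
    (straightFree r n).card + (withStraight r n).card = r.choose n := by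
  classical
  rw [add_comm, straightFree, withStraight, card_filter_add_card_filter_not, card_powersetCard,
    card_univ, Fintype.card_fin]

/-- Five consecutive ranks starting at `k`. -/
def run (r k : ℕ) : Finset (Fin r) := univ.filter fun a => k ≤ a ∧ (a : ℕ) < k + 5

/-- The ranks not in the run starting at `k` and different from `k + 5`. -/
def offRun (r k : ℕ) : Finset (Fin r) := univ.filter fun a => (a : ℕ) < k ∨ k + 5 < a

theorem mem_run {k : ℕ} {a : Fin r} : a ∈ run r k ↔ k ≤ a ∧ (a : ℕ) < k + 5 := by
  simp [run]

theorem mem_offRun {k : ℕ} {a : Fin r} : a ∈ offRun r k ↔ (a : ℕ) < k ∨ k + 5 < a := by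
  simp [offRun]

theorem run_map {k : ℕ} (hk : k + 5 ≤ r) :
    (run r k).map Fin.valEmbedding = Ico k (k + 5) := by
  ext n
  simp only [mem_map, mem_run, Fin.valEmbedding_apply, mem_Ico]
  constructor
  · rintro ⟨a, h, rfl⟩
    exact h
  · exact fun h => ⟨⟨n, by omega⟩, h, rfl⟩

theorem card_run {k : ℕ} (hk : k + 5 ≤ r) : (run r k).card = 5 := by
  rw [← card_map Fin.valEmbedding, run_map hk, Nat.card_Ico]
  omega

theorem isStraightRanks_run {k : ℕ} (hk : k + 5 ≤ r) : IsStraightRanks (run r k) :=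
  ⟨card_run hk, .inl ⟨k, run_map hk⟩⟩

theorem disjoint_run_offRun (r k : ℕ) : Disjoint (run r k) (offRun r k) := by
  rw [disjoint_left]
  intro a h1 h2
  rw [mem_run] at h1
  rw [mem_offRun] at h2
  omega

theorem le_card_offRun (r k : ℕ) : r - 6 ≤ (offRun r k).card := by
  have h1 : (offRun r k)ᶜ.card ≤ 6 := by
    rw [← card_map Fin.valEmbedding, show 6 = (Ico k (k + 6)).card by simp]
    refine card_le_card fun n hn => ?_
    obtain ⟨a, ha, rfl⟩ := mem_map.1 hn
    rw [mem_compl, mem_offRun] at ha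
    rw [Fin.valEmbedding_apply, mem_Ico]
    omega
  rw [card_compl, Fintype.card_fin] at h1
  omega

/-- Because `k + 5` is missing from the union, `k` is its last run start. A run starting in `k + 1,
..., k + 5` would contain `k + 5`, and a later one would lie inside `X`, which has fewer than five
elements. -/
theorem le_of_run_union_eq {n k k' : ℕ} (hn : n < 5) (hk' : k' + 5 ≤ r)
    {X X' : Finset (Fin r)} (hX : X ⊆ offRun r k) (hXn : X.card = n)
    (h : run r k ∪ X = run r k' ∪ X') : k' ≤ k := by
  by_contra! hlt
  rcases Nat.lt_or_ge (k + 5) k' with h1 | h1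
  · have h2 : run r k' ⊆ X := by
      intro a ha
      have h3 : a ∈ run r k ∪ X := h ▸ mem_union_left _ ha
      rw [mem_run] at ha
      rcases mem_union.1 h3 with h4 | h4
      · rw [mem_run] at h4
        omega
      · exact h4
    have := card_le_card h2
    rw [card_run hk'] at this
    omega
  · have h2 : (⟨k + 5, by omega⟩ : Fin r) ∈ run r k ∪ X := by
      rw [h]
      refine mem_union_left _ (mem_run.2 ?_)
      dsimp only
      omega
    rcases mem_union.1 h2 with h3 | h3
    · rw [mem_run] at h3
      dsimp only at h3
      omega
    · have := mem_offRun.1 (hX h3)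
      dsimp only at this
      omega

/-- Attaching `n` ranks off the run to each of the `r - 4` runs is injective, since the union
determines its last run. The ace-low straight is not used. -/
theorem le_card_withStraight (hr : 5 ≤ r) {n : ℕ} (hn : n < 5) :
    (r - 4) * (r - 6).choose n ≤ (withStraight r (n + 5)).card := by
  have h1 : (r - 4) * (r - 6).choose n ≤
      ((range (r - 4)).sigma fun k => powersetCard n (offRun r k)).card := by
    rw [card_sigma]
    conv_lhs => rw [← card_range (r - 4), ← smul_eq_mul]
    refine card_nsmul_le_sum _ _ _ fun k _ => ?_
    rw [card_powersetCard]
    exact Nat.choose_le_choose _ (le_card_offRun r k)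
  refine h1.trans (card_le_card_of_injOn (fun x => run r x.1 ∪ x.2) ?_ ?_)
  · rintro ⟨k, X⟩ h
    rw [mem_coe, mem_sigma, mem_range, mem_powersetCard] at h
    dsimp only at h
    obtain ⟨h2, h3, h4⟩ := h
    have h5 : k + 5 ≤ r := by omega
    rw [mem_coe, mem_withStraight, card_union_of_disjoint
      (disjoint_of_subset_right h3 (disjoint_run_offRun r k)), card_run h5, h4]
    exact ⟨add_comm _ _, _, subset_union_left, isStraightRanks_run h5⟩
  · rintro ⟨k, X⟩ h ⟨k', X'⟩ h' heq
    rw [mem_coe, mem_sigma, mem_range, mem_powersetCard] at h h'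
    dsimp only at h h' heq
    have h2 := le_of_run_union_eq hn (by omega) h.2.1 h.2.2 heq
    have h3 := le_of_run_union_eq hn (by omega) h'.2.1 h'.2.2 heq.symm
    obtain rfl : k = k' := le_antisymm h3 h2
    have h4 : ∀ {Y}, Y ⊆ offRun r k → (run r k ∪ Y) \ run r k = Y := fun hY =>
      union_sdiff_cancel_left (disjoint_of_subset_right hY (disjoint_run_offRun r k))
    rw [← h4 h.2.1, ← h4 h'.2.1, heq]

/-- Only hands with seven ranks, or with six ranks and a pair, are counted; straights on exactly
five ranks are dropped. -/
theorem le_freq_ST (r : ℕ) :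
    (withStraight r 7).card * 4 ^ 7 + (withStraight r 6).card * (6 * (6 * 4 ^ 5)) ≤
      freq r .ST := by
  classical
  rw [← card_ofType_single_filter (fun _ => True) (k := 7) (fun B hB => by
      rw [filter_true, card_single, hB]) (withStraight r 7) fun B hB => (mem_withStraight.1 hB).1,
    ← card_ofType_pair_filter (fun _ => True) (k := 5) (fun b B hb hB => by
      rw [filter_true, card_pairSingle b B hb, hB]) (withStraight r 6)
      fun B hB => (mem_withStraight.1 hB).1, ← card_union_of_disjoint]
  · unfold freq
    refine card_le_card fun s hs => ?_
    rw [mem_union, mem_filter, mem_filter] at hs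
    rw [mem_filter, mem_sevenCardHands, contains_ST_iff]
    rcases hs with ⟨h1, h2, -⟩ | ⟨h1, h2, -⟩
    · exact ⟨card_of_mem_ofType h1, (mem_withStraight.1 h2).2⟩
    · exact ⟨card_of_mem_ofType h1, (mem_withStraight.1 h2).2⟩
  · rw [disjoint_left]
    intro s h1 h2
    rw [mem_filter, mem_ofType] at h1 h2
    omega

/-! ### The rankings agree for `r = 23`. -/

theorem showdownRanking_twentyThree : showdownRanking 23 = freqRanking 23 := by
  have hr : 5 ≤ 23 := by norm_num
  have uSF : freq 23 .SF ≤ 299280 := (freq_SF_le hr).trans (by norm_num [Nat.choose])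
  have uX4 : freq 23 .X4 ≤ 2523928 := (freq_X4_le 23).trans (by norm_num [Nat.choose])
  have uFH : freq 23 .FH ≤ 47495736 := (freq_FH_le 23).trans (by norm_num [Nat.choose])
  have uST : freq 23 .ST ≤ 76615680 := (freq_ST_le hr).trans (by norm_num [Nat.choose])
  have uX3 : freq 23 .X3 ≤ 224629592 := (freq_X3_le 23).trans (by norm_num [Nat.choose])
  have eFL : freq 23 .FL = 344604216 := (freq_FL_eq 23).trans (by norm_num [Nat.choose])
  have uP2 : freq 23 .P2 ≤ 2092336312 := (freq_P2_le 23).trans (by norm_num [Nat.choose])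
  -- `3060 = 20 * 153`; the lower bounds below are `2584 = 19 * 136` and `323 = 19 * 17`.
  have c7 : (withStraight 23 7).card ≤ 3060 := by
    classical
    exact (card_filter_hasStraight_le hr 7).trans (by norm_num [Nat.choose])
  have c7' : 2584 ≤ (withStraight 23 7).card :=
    le_trans (by norm_num [Nat.choose]) (le_card_withStraight hr (n := 2) (by norm_num))
  have c6' : 323 ≤ (withStraight 23 6).card :=
    le_trans (by norm_num) (le_card_withStraight hr (n := 1) (by norm_num))
  have c7f := card_straightFree_add_card_withStraight 23 7
  have hc : Nat.choose 23 7 = 245157 := by norm_num [Nat.choose]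
  have lX4 := le_countAvoiding_X4 23
  have tX4 : (ofType 23 1 0 0 3).card = 2266880 :=
    (card_ofType _ _ _ _ _).trans (by norm_num [Nat.choose])
  have lFH := le_countAvoiding_FH 23
  have tFH : (ofType 23 0 1 1 2).card = 40803840 :=
    (card_ofType _ _ _ _ _).trans (by norm_num [Nat.choose])
  have lST := le_countAvoiding_ST 23
  have tST := le_freq_ST 23
  have lX3 := le_countAvoiding_X3 23
  have tX3 : (ofType 23 0 1 0 4).card = 172282880 :=
    (card_ofType _ _ _ _ _).trans (by norm_num [Nat.choose])
  have lFL := le_countAvoiding_FL 23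
  have tFL : _ ≤ 18574248 := (card_filter_FL_X3_le 23).trans (by norm_num [Nat.choose])
  have lP2 := le_countAvoiding_P2 23
  have tP2 : (ofType 23 0 0 2 3).card = 775272960 :=
    (card_ofType _ _ _ _ _).trans (by norm_num [Nat.choose])
  have lP1 := le_countAvoiding_P1 23
  have tP1 : (ofType 23 0 0 1 5).card = 3721310208 :=
    (card_ofType _ _ _ _ _).trans (by norm_num [Nat.choose])
  have lHC := le_countAvoiding_HC 23
  have f := countAvoiding_le_freq 23
  have f1 : freq 23 .SF < freq 23 .X4 := by have := f .X4 [.SF]; omega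
  have f2 : freq 23 .X4 < freq 23 .FH := by have := f .FH [.SF, .X4]; omega
  have f3 : freq 23 .FH < freq 23 .ST := by have := f .ST [.SF, .X4, .FH]; omega
  have f4 : freq 23 .ST < freq 23 .X3 := by have := f .X3 [.SF, .X4, .FH, .ST]; omega
  have f5 : freq 23 .X3 < freq 23 .FL := by omega
  have f6 : freq 23 .FL < freq 23 .P2 := by
    have := f .P2 [.SF, .X4, .FH, .ST, .X3, .FL]; omega
  have f7 : freq 23 .P2 < freq 23 .P1 := by
    have := f .P1 [.SF, .X4, .FH, .ST, .X3, .FL, .P2]; omega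
  have f8 : freq 23 .P1 < freq 23 .HC := freq_P1_lt (by norm_num)
  have u := showdownFreq_le_freq 23 (freqRanking 23)
  -- Here and below, a type outside the list cannot be ranked above, by the chain `f1` to `f8`.
  have g1 : _ ≤ showdownFreq 23 (freqRanking 23) .X4 :=
    countAvoiding_le_showdownFreq (l := [.SF]) fun h' hh => by cases h' <;> simp <;> omega
  have g2 : _ ≤ showdownFreq 23 (freqRanking 23) .FH :=
    countAvoiding_le_showdownFreq (l := [.SF, .X4]) fun h' hh => by cases h' <;> simp <;> omega
  have g3 : _ ≤ showdownFreq 23 (freqRanking 23) .ST :=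
    countAvoiding_le_showdownFreq (l := [.SF, .X4, .FH])
      fun h' hh => by cases h' <;> simp <;> omega
  have g4 : _ ≤ showdownFreq 23 (freqRanking 23) .X3 :=
    countAvoiding_le_showdownFreq (l := [.SF, .X4, .FH, .ST])
      fun h' hh => by cases h' <;> simp <;> omega
  have g5 : _ ≤ showdownFreq 23 (freqRanking 23) .FL :=
    countAvoiding_le_showdownFreq (l := [.SF, .X4, .FH, .ST, .X3])
      fun h' hh => by cases h' <;> simp <;> omega
  have g6 : _ ≤ showdownFreq 23 (freqRanking 23) .P2 :=
    countAvoiding_le_showdownFreq (l := [.SF, .X4, .FH, .ST, .X3, .FL])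
      fun h' hh => by cases h' <;> simp <;> omega
  have g7 : _ ≤ showdownFreq 23 (freqRanking 23) .P1 :=
    countAvoiding_le_showdownFreq (l := [.SF, .X4, .FH, .ST, .X3, .FL, .P2])
      fun h' hh => by cases h' <;> simp <;> omega
  have g8 : _ ≤ showdownFreq 23 (freqRanking 23) .HC :=
    countAvoiding_le_showdownFreq (l := [.SF, .X4, .FH, .ST, .X3, .FL, .P2, .P1])
      fun h' hh => by cases h' <;> simp; omega
  -- The bound `freq 23 .P1` is too weak for the last comparison. With `g9` it becomes `3721310208 <
  -- (245157 - 3060) * 15540 = 3762187380`.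
  have g9 := showdownFreq_P1_le (r := 23) f7 (by omega)
  have s1 : showdownFreq 23 (freqRanking 23) .SF < showdownFreq 23 (freqRanking 23) .X4 := by
    have := u .SF; omega
  have s2 : showdownFreq 23 (freqRanking 23) .X4 < showdownFreq 23 (freqRanking 23) .FH := by
    have := u .X4; omega
  have s3 : showdownFreq 23 (freqRanking 23) .FH < showdownFreq 23 (freqRanking 23) .ST := by
    have := u .FH; omega
  have s4 : showdownFreq 23 (freqRanking 23) .ST < showdownFreq 23 (freqRanking 23) .X3 := by
    have := u .ST; omega
  have s5 : showdownFreq 23 (freqRanking 23) .X3 < showdownFreq 23 (freqRanking 23) .FL := by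
    have := u .X3; omega
  have s6 : showdownFreq 23 (freqRanking 23) .FL < showdownFreq 23 (freqRanking 23) .P2 := by
    have := u .FL; omega
  have s7 : showdownFreq 23 (freqRanking 23) .P2 < showdownFreq 23 (freqRanking 23) .P1 := by
    have := u .P2; omega
  have s8 : showdownFreq 23 (freqRanking 23) .P1 < showdownFreq 23 (freqRanking 23) .HC := by
    omega
  -- Two strict chains in the same order decide all 81 comparisons.
  clear * - f1 f2 f3 f4 f5 f6 f7 f8 s1 s2 s3 s4 s5 s6 s7 s8
  funext h₀ h₁
  refine propext ?_
  unfold showdownRanking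
  change _ ↔ freq 23 h₀ < freq 23 h₁
  cases h₀ <;> cases h₁ <;> omega

end Poker

theorem mainTheorem5 :
    IsLeast {r : ℕ | 5 ≤ r ∧ Poker.showdownRanking r = Poker.freqRanking r} 23 := by
  refine ⟨⟨by norm_num, Poker.showdownRanking_twentyThree⟩, fun r hr => ?_⟩
  by_contra! h
  exact Poker.showdownRanking_ne_freqRanking hr.1 (by omega) hr.2
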